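/- Let $n\in\{1,2\}$ and $B=[-1,1)^n$; "periodic" means $2$-periodic in each coordinate. Let $\Gamma=\{-\tfrac12,\tfrac12\}$ if $n=1$, and let $\Gamma\subset B$ be a smooth ($C^\infty$) simple closed curve if $n=2$. Let $\sigma_\Gamma$ be the counting measure on $\Gamma$ if $n=1$ and the arc-length measure if $n=2$, let $L^2(\Gamma)=L^2(\Gamma,\sigma_\Gamma)$, and let $\nu$ be the outward unit normal to $(-\tfrac12,\tfrac12)$ at $\pm\tfrac12$ if $n=1$, and a continuous unit normal field on $\Gamma$ (on either side) if $n=2$. For $\lambda\in\mathbb R$ let $\Gamma_\lambda=\{y+\lambda\nu(y): y\in\Gamma\}$. Let $\sigma\in[0,1)$ and let $\alpha:\mathbb R^n\to\mathbb R$ be periodic, continuous and locally Hölder continuous of exponent $\sigma$ off $\Gamma$ and its periodic translates, and such that for some $c\ge1$ $$\tfrac1c\,d(x,\Gamma)^\sigma\le\alpha(x)\le c\,d(x,\Gamma)^\sigma\quad\text{for all }x\in B,\qquad d(x,\Gamma)=\inf_{y\in\Gamma}|x-y|$$ (with $0^0=1$). Let $H^1_{\pi,\alpha}(B)$ be the space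 of real-valued periodic functions $u\in L^2(B)$ whose distributional gradient $\nabla u$ is a periodic function with $|\nabla u|\in L^1(B)$ and $\int_B\alpha|\nabla u|^2\,dx<\infty$, with norm $$\|u\|_{H^1_{\pi,\alpha}(B)}=\Big(\int_B u^2\,dx+\int_B\alpha|\nabla u|^2\,dx\Big)^{1/2}.$$ For $g\in L^2(\Gamma)$ we say that $g$ is the trace of $u$ on $\Gamma_\lambda$ if there are an open set $U\supset\Gamma_\lambda$ and functions $\varphi_k\in C^\infty(\mathbb R^n)$ such that $\varphi_k\to u$ and $\nabla\varphi_k\to\nabla u$ in $L^2(U)$ and $\varphi_k(\cdot+\lambda\nu(\cdot))\to g$ in $L^2(\Gamma)$ as $k\to\infty$. Then every $u\in H^1_{\pi,\alpha}(B)$ has a trace $\gamma_\Gamma(u)\in L^2(\Gamma)$ on $\Gamma$. More precisely, there is a linear map $\gamma_\Gamma:H^1_{\pi,\alpha}(B)\to L^2(\Gamma)$ such that: 1. there is $C$ with $\|\gamma_\Gamma(u)\|_{L^2(\Gamma)}\le C\,\|u\|_{H^1_{\pi,\alpha}(B)}$ for all $u\in H^1_{\pi,\alpha}(B)$; 2.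 $\gamma_\Gamma(u)=u|_\Gamma$ ($\sigma_\Gamma$-almost everywhere) for every $u\in C^\infty(\mathbb R^n)\cap H^1_{\pi,\alpha}(B)$; 3. there is $\Lambda>0$ such that for all $0<|\lambda|<\Lambda$ every $u\in H^1_{\pi,\alpha}(B)$ has exactly one trace $\gamma_{\Gamma_\lambda}(u)\in L^2(\Gamma)$ on $\Gamma_\lambda$, and for every $u\in H^1_{\pi,\alpha}(B)$ $$\gamma_{\Gamma_\lambda}(u)\to\gamma_\Gamma(u)\ \text{ in }L^2(\Gamma)\quad\text{as }\lambda\to0,\ \lambda\neq0.$$ -/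

import Mathlib

open MeasureTheory Filter Set Topology
open scoped ContDiff ENNReal

namespace Degenerate

/-- Euclidean `n`-space (with the Euclidean norm and Lebesgue measure). -/
abbrev Space (n : ℕ) := EuclideanSpace ℝ (Fin n)

/-- The periodicity box `B = [-1, 1)^n`. -/
def box (n : ℕ) : Set (Space n) := {x | ∀ i, x i ∈ Ico (-1 : ℝ) 1}

/-- `f` is `2`-periodic in every coordinate direction. -/
def IsPeriodic {n : ℕ} {F : Type*} (f : Space n → F) : Prop :=
  ∀ (x : Space n) (i : Fin n), f (x + EuclideanSpace.single i (2 : ℝ)) = f x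

/-- The union of all translates of `Γ` by the period lattice `2ℤ^n`. -/
def periodicHull {n : ℕ} (Γ : Set (Space n)) : Set (Space n) :=
  {x | ∃ k : Fin n → ℤ, x + WithLp.toLp 2 (fun i => 2 * (k i : ℝ)) ∈ Γ}

/-- `Γ = {-1/2, 1/2}` in dimension one, with its counting measure `μ` and its outward unit
normal `ν` (outward for the interval `(-1/2, 1/2)`). -/
structure IsPointPair {n : ℕ} (Γ : Set (Space n)) (μ : Measure (Space n))
    (ν : Space n → Space n) : Prop where
  dim : n = 1
  set_eq : Γ = {WithLp.toLp 2 (fun _ => (1 / 2 : ℝ)), WithLp.toLp 2 (fun _ => (-(1 / 2) : ℝ))}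
  measure_eq : μ = Measure.dirac (WithLp.toLp 2 (fun _ => (1 / 2 : ℝ))) +
    Measure.dirac (WithLp.toLp 2 (fun _ => (-(1 / 2) : ℝ)))
  normal_right : ν (WithLp.toLp 2 (fun _ => (1 / 2 : ℝ))) = WithLp.toLp 2 (fun _ => (1 : ℝ))
  normal_left : ν (WithLp.toLp 2 (fun _ => (-(1 / 2) : ℝ))) = WithLp.toLp 2 (fun _ => (-1 : ℝ))

/-- `Γ ⊆ B` is a smooth simple closed curve in the plane, parametrized by arc length by `γ` over
one period `[0, L)`; `μ` is its arc-length measure and `ν` a continuous unit normal field on it.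
There are two such fields, the outward one and its negative; both are admitted. -/
structure IsSmoothClosedCurve {n : ℕ} (Γ : Set (Space n)) (μ : Measure (Space n))
    (ν : Space n → Space n) (L : ℝ) (γ : ℝ → Space n) : Prop where
  dim : n = 2
  length_pos : 0 < L
  smooth : ContDiff ℝ ∞ γ
  closed : Function.Periodic γ L
  simple : InjOn γ (Ico 0 L)
  unit_speed : ∀ t, ‖deriv γ t‖ = 1
  set_eq : Γ = range γ
  subset_box : Γ ⊆ box n
  measure_eq : μ = (volume.restrict (Ico 0 L)).map γ
  normal_cont : ContinuousOn ν Γ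
  normal_unit : ∀ t, ‖ν (γ t)‖ = 1
  normal_orth : ∀ t, inner ℝ (ν (γ t)) (deriv γ t) = 0

/-- The degeneration sets `Γ` (with surface measure `μ` and unit normal `ν`):
the points `±1/2` if `n = 1`, a smooth closed curve in `B` if `n = 2`. -/
def IsDegenerationSet {n : ℕ} (Γ : Set (Space n)) (μ : Measure (Space n))
    (ν : Space n → Space n) : Prop :=
  IsPointPair Γ μ ν ∨ ∃ (L : ℝ) (γ : ℝ → Space n), IsSmoothClosedCurve Γ μ ν L γ

/-- The class of diffusivities `α` of exponent `s ∈ [0, 1)` degenerating on `Γ`: periodic,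
continuous and locally Hölder continuous of exponent `s` off (the periodic extension of) `Γ`, and
comparable to `d(x, Γ)^s` on `B`. The two-sided bound makes `α` bounded and nonnegative and, for
`0 < s`, makes its zeros in `B` exactly the points of `Γ`; for `s = 0` it says that `α` is bounded
and bounded away from `0`, as `0 ^ 0 = 1`. -/
structure IsDiffusivity {n : ℕ} (Γ : Set (Space n)) (s : ℝ) (α : Space n → ℝ) : Prop where
  exponent : s ∈ Ico (0 : ℝ) 1
  periodic : IsPeriodic α
  continuous_off : ContinuousOn α (periodicHull Γ)ᶜ
  holder_off : ∀ x ∉ periodicHull Γ, ∃ U ∈ 𝓝 x, ∃ C : ℝ,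
    ∀ y ∈ U, ∀ z ∈ U, |α y - α z| ≤ C * dist y z ^ s
  comparable : ∃ c : ℝ, 1 ≤ c ∧ ∀ x ∈ box n,
    c⁻¹ * Metric.infDist x Γ ^ s ≤ α x ∧ α x ≤ c * Metric.infDist x Γ ^ s

/-- `G` is a locally integrable weak (distributional) gradient of `u` on `ℝ^n`. -/
structure IsWeakGradient {n : ℕ} (u : Space n → ℝ) (G : Space n → Space n) : Prop where
  locInt : LocallyIntegrable u volume
  locInt_grad : LocallyIntegrable G volume
  by_parts : ∀ φ : Space n → ℝ, ContDiff ℝ ∞ φ → HasCompactSupport φ →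
    ∫ x, u x • gradient φ x = - ∫ x, φ x • G x

theorem integrable_smul_gradient {n : ℕ} {u : Space n → ℝ} (hu : LocallyIntegrable u volume)
    {φ : Space n → ℝ} (hφ : ContDiff ℝ ∞ φ) (hc : HasCompactSupport φ) :
    Integrable (fun x => u x • gradient φ x) volume := by
  have h1 : Continuous (gradient φ) :=
    (InnerProductSpace.toDual ℝ (Space n)).symm.continuous.comp (hφ.continuous_fderiv (by simp))
  have h2 : HasCompactSupport (gradient φ) := by
    refine (hc.fderiv (𝕜 := ℝ)).comp_left (g := (InnerProductSpace.toDual ℝ (Space n)).symm) ?_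
    simp
  exact hu.integrable_smul_right_of_hasCompactSupport h1 h2

theorem integrable_smul_field {n : ℕ} {G : Space n → Space n} (hG : LocallyIntegrable G volume)
    {φ : Space n → ℝ} (hφ : ContDiff ℝ ∞ φ) (hc : HasCompactSupport φ) :
    Integrable (fun x => φ x • G x) volume :=
  hG.integrable_smul_left_of_hasCompactSupport hφ.continuous hc

theorem IsWeakGradient.add {n : ℕ} {u v : Space n → ℝ} {G H : Space n → Space n}
    (hu : IsWeakGradient u G) (hv : IsWeakGradient v H) : IsWeakGradient (u + v) (G + H) where
  locInt := hu.locInt.add hv.locInt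
  locInt_grad := hu.locInt_grad.add hv.locInt_grad
  by_parts φ hφ hc := by
    simp only [Pi.add_apply, add_smul, smul_add]
    rw [integral_add (integrable_smul_gradient hu.locInt hφ hc)
        (integrable_smul_gradient hv.locInt hφ hc),
      integral_add (integrable_smul_field hu.locInt_grad hφ hc)
        (integrable_smul_field hv.locInt_grad hφ hc), hu.by_parts φ hφ hc, hv.by_parts φ hφ hc]
    abel

theorem IsWeakGradient.smul {n : ℕ} {u : Space n → ℝ} {G : Space n → Space n}
    (hu : IsWeakGradient u G) (c : ℝ) : IsWeakGradient (c • u) (c • G) where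
  locInt := hu.locInt.smul c
  locInt_grad := hu.locInt_grad.smul c
  by_parts φ hφ hc := by
    have := hu.by_parts φ hφ hc
    simp only [Pi.smul_apply, smul_assoc, smul_comm _ c]
    rw [integral_smul, integral_smul, this, smul_neg]

theorem IsWeakGradient.zero {n : ℕ} :
    IsWeakGradient (0 : Space n → ℝ) (0 : Space n → Space n) where
  locInt := locallyIntegrable_zero
  locInt_grad := locallyIntegrable_zero
  by_parts φ _ _ := by simp

/-- The weighted space `H¹_{π,α}(B)` of periodic functions `u`, square integrable over `B`, whose
weak gradient is a periodic (locally) integrable function with `√α ∇u` square integrable over `B`.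
Its elements are functions; the norm below only sees them up to equality almost everywhere. -/
def weightedH1 {n : ℕ} (α : Space n → ℝ) : Submodule ℝ (Space n → ℝ) where
  carrier := {u | IsPeriodic u ∧ MemLp u 2 (volume.restrict (box n)) ∧
    ∃ G : Space n → Space n, IsPeriodic G ∧ IsWeakGradient u G ∧
      MemLp (fun x => √(α x) • G x) 2 (volume.restrict (box n))}
  zero_mem' := ⟨fun _ _ => rfl, MemLp.zero, 0, fun _ _ => rfl, IsWeakGradient.zero, by simp⟩
  add_mem' := by
    rintro u v ⟨hu, hu2, G, hG, huG, hG2⟩ ⟨hv, hv2, H, hH, hvH, hH2⟩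
    refine ⟨fun x i => ?_, hu2.add hv2, G + H, fun x i => ?_, huG.add hvH, ?_⟩
    · simp only [Pi.add_apply, hu x i, hv x i]
    · simp only [Pi.add_apply, hG x i, hH x i]
    · have h : (fun x => √(α x) • (G + H) x) =
          (fun x => √(α x) • G x) + fun x => √(α x) • H x := by
        ext1 x; simp only [Pi.add_apply, smul_add]
      rw [h]; exact hG2.add hH2
  smul_mem' := by
    rintro c u ⟨hu, hu2, G, hG, huG, hG2⟩
    refine ⟨fun x i => ?_, hu2.const_smul c, c • G, fun x i => ?_, huG.smul c, ?_⟩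
    · simp only [Pi.smul_apply, hu x i]
    · simp only [Pi.smul_apply, hG x i]
    · have h : (fun x => √(α x) • (c • G) x) = c • fun x => √(α x) • G x := by
        ext1 x; simp only [Pi.smul_apply, smul_comm _ c]
      rw [h]; exact hG2.const_smul c

open Classical in
/-- The weak gradient of `u` (unique up to equality almost everywhere; `0` if there is none). -/
noncomputable def weakGrad {n : ℕ} (u : Space n → ℝ) : Space n → Space n :=
  if h : ∃ G, IsWeakGradient u G then h.choose else 0

/-- The norm `(‖u‖₂² + ‖√α ∇u‖₂²)^{1/2}` of `H¹_{π,α}(B)`, with integrals over `B`. -/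
noncomputable def weightedH1Norm {n : ℕ} (α : Space n → ℝ) (u : Space n → ℝ) : ℝ :=
  √((∫ x in box n, u x ^ 2) + ∫ x in box n, α x * ‖weakGrad u x‖ ^ 2)

/-- The map `y ↦ y + l ν(y)`, which carries `Γ` onto the parallel set `Γ_l`. -/
def parallel {n : ℕ} (ν : Space n → Space n) (l : ℝ) (y : Space n) : Space n := y + l • ν y

/-- `g ∈ L²(Γ)` is the trace of `u` on the set `p(Γ)`, read as a function on `Γ` through `p`: the
trace is the extension by continuity of the restriction of smooth functions, i.e. there are smooth
functions `φ k` with `φ k → u` in `H¹(U)` for some open neighbourhood `U` of `p(Γ)`, and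
`φ k ∘ p → g` in `L²(Γ)`. -/
def IsTraceAlong {n : ℕ} (Γ : Set (Space n)) (μ : Measure (Space n)) (p : Space n → Space n)
    (u : Space n → ℝ) (g : Lp ℝ 2 μ) : Prop :=
  ∃ U : Set (Space n), IsOpen U ∧ (∀ y ∈ Γ, p y ∈ U) ∧
    ∃ φ : ℕ → Space n → ℝ, (∀ k, ContDiff ℝ ∞ (φ k)) ∧
      Tendsto (fun k => eLpNorm (fun x => φ k x - u x) 2 (volume.restrict U)) atTop (𝓝 0) ∧
      Tendsto (fun k => eLpNorm (fun x => gradient (φ k) x - weakGrad u x) 2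
        (volume.restrict U)) atTop (𝓝 0) ∧
      Tendsto (fun k => eLpNorm (fun y => φ k (p y) - g y) 2 μ) atTop (𝓝 0)

end Degenerate

namespace Degenerate

open scoped Convolution

theorem lintegral_enorm_pow_eq_eLpNorm_pow {X F : Type*} [MeasurableSpace X]
    [NormedAddCommGroup F] {m : Measure X} (w : X → F) {q : ℕ} (hq : 1 ≤ q) :
    ∫⁻ x, ‖w x‖ₑ ^ q ∂m = eLpNorm w q m ^ q := by
  have h0 : (q : ℝ≥0∞) ≠ 0 := by exact_mod_cast (by omega : q ≠ 0)
  have hr : (q : ℝ) ≠ 0 := by exact_mod_cast (by omega : q ≠ 0)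
  rw [eLpNorm_eq_lintegral_rpow_enorm_toReal h0 (ENNReal.natCast_ne_top q), ← ENNReal.rpow_natCast,
    ← ENNReal.rpow_mul]
  simp [hr]

/-- Jensen's inequality for natural powers with respect to a probability measure. -/
theorem lintegral_pow_le_lintegral_pow {X : Type*} [MeasurableSpace X] {m : Measure X}
    [IsProbabilityMeasure m] {g : X → ℝ≥0∞} (hg : Measurable g) {q : ℕ} (hq : 1 ≤ q) :
    (∫⁻ x, g x ∂m) ^ q ≤ ∫⁻ x, g x ^ q ∂m := by
  have h := eLpNorm'_le_eLpNorm'_of_exponent_le (f := g) (p := 1) (q := q) one_pos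
    (by exact_mod_cast hq) m hg.aestronglyMeasurable
  simp only [eLpNorm', enorm_eq_self, ENNReal.rpow_one, div_one, ENNReal.rpow_natCast] at h
  have hr : (q : ℝ) ≠ 0 := by exact_mod_cast (by omega : q ≠ 0)
  calc (∫⁻ x, g x ∂m) ^ q ≤ ((∫⁻ x, g x ^ q ∂m) ^ (1 / (q : ℝ))) ^ q := by gcongr
    _ = ∫⁻ x, g x ^ q ∂m := by
      rw [← ENNReal.rpow_natCast, ← ENNReal.rpow_mul]
      simp [hr]

/-- Translations act continuously on `L^q`. -/
theorem tendsto_lintegral_translate_sub {n : ℕ} {F : Type*} [NormedAddCommGroup F]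
    {w : Space n → F} {q : ℕ} (hq : 1 ≤ q) (hw : MemLp w q volume) :
    Tendsto (fun z => ∫⁻ x, ‖w (x - z) - w x‖ₑ ^ q) (𝓝 0) (𝓝 0) := by
  have : Fact ((1 : ℝ≥0∞) ≤ q) := ⟨by exact_mod_cast hq⟩
  let g : C(Space n, C(Space n, Space n)) :=
    ContinuousMap.curry ⟨fun a : Space n × Space n => a.2 - a.1, by fun_prop⟩
  have hgm : ∀ z, MeasurePreserving (g z) (volume : Measure (Space n)) volume := fun z =>
    measurePreserving_sub_right volume z
  have h := Filter.Tendsto.compMeasurePreservingLp (f := fun _ : Space n => hw.toLp w)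
    (tendsto_const_nhds (x := hw.toLp w) (f := 𝓝 0)) (g.continuous.tendsto 0) hgm (hgm 0)
    (ENNReal.natCast_ne_top q)
  rw [tendsto_iff_edist_tendsto_0] at h
  have h2 := (ENNReal.continuous_pow q).tendsto 0 |>.comp h
  rw [zero_pow (by omega)] at h2
  refine h2.congr fun z => ?_
  rw [lintegral_enorm_pow_eq_eLpNorm_pow _ hq, Function.comp_apply, Lp.edist_def]
  congr 1
  refine eLpNorm_congr_ae ?_
  have e1 := Lp.coeFn_compMeasurePreserving (hw.toLp w) (hgm z)
  have e2 := Lp.coeFn_compMeasurePreserving (hw.toLp w) (hgm 0)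
  have e3 := hw.coeFn_toLp
  have e4 := (hgm z).quasiMeasurePreserving.ae_eq_comp e3
  have e5 := (hgm 0).quasiMeasurePreserving.ae_eq_comp e3
  filter_upwards [e1, e2, e4, e5] with x h1 h2 h4 h5
  simp only [Pi.sub_apply, h1, h2, h4, h5]
  simp [g]

/-- A sequence of smooth bump functions shrinking to the origin. -/
noncomputable def bump (n k : ℕ) : ContDiffBump (0 : Space n) where
  rIn := 1 / (k + 2)
  rOut := 1 / (k + 1)
  rIn_pos := by positivity
  rIn_lt_rOut := by gcongr; norm_num

/-- The convolution of `w` with the `k`-th normed bump function. -/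
noncomputable def moll {n : ℕ} {F : Type*} [NormedAddCommGroup F] [NormedSpace ℝ F] (k : ℕ)
    (w : Space n → F) : Space n → F :=
  (bump n k).normed volume ⋆[ContinuousLinearMap.lsmul ℝ ℝ, volume] w

section Mollifier

variable {n : ℕ} {F : Type*} [NormedAddCommGroup F] [NormedSpace ℝ F]

theorem moll_apply (k : ℕ) (w : Space n → F) (x : Space n) :
    moll k w x = ∫ z, (bump n k).normed volume z • w (x - z) := rfl

theorem moll_apply_swap (k : ℕ) (w : Space n → F) (x : Space n) :
    moll k w x = ∫ z, (bump n k).normed volume (x - z) • w z := by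
  simp [moll, convolution_eq_swap]

theorem tendsto_bump_rOut (n : ℕ) : Tendsto (fun k => (bump n k).rOut) atTop (𝓝 0) :=
  tendsto_one_div_add_atTop_nhds_zero_nat

theorem integrable_bump_smul {w : Space n → F} (hw : LocallyIntegrable w volume) (k : ℕ)
    (x : Space n) : Integrable (fun z => (bump n k).normed volume z • w (x - z)) := by
  have h := hw.integrable_smul_left_of_hasCompactSupport
    (g := fun z => (bump n k).normed volume (x - z))
    ((bump n k).continuous_normed.comp (by fun_prop))
    ((bump n k).hasCompactSupport_normed.comp_homeomorph (Homeomorph.subLeft x))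
  simpa using h.comp_sub_left x

theorem contDiff_moll {w : Space n → F} (hw : LocallyIntegrable w volume) (k : ℕ) :
    ContDiff ℝ ∞ (moll k w) :=
  (bump n k).hasCompactSupport_normed.contDiff_convolution_left _
    ((bump n k).contDiff_normed (n := ⊤)) hw

theorem moll_add {v w : Space n → F} (hv : LocallyIntegrable v volume)
    (hw : LocallyIntegrable w volume) (k : ℕ) : moll k (v + w) = moll k v + moll k w := by
  ext x
  simp only [moll_apply, Pi.add_apply, smul_add]
  exact integral_add (integrable_bump_smul hv k x) (integrable_bump_smul hw k x)

theorem moll_smul (c : ℝ) (w : Space n → F) (k : ℕ) : moll k (c • w) = c • moll k w := by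
  ext x
  simp only [moll_apply, Pi.smul_apply, smul_comm _ c]
  exact integral_smul c _

theorem moll_congr_ae {v w : Space n → F} (h : v =ᵐ[volume] w) (k : ℕ) :
    moll k v = moll k w := by
  ext x
  rw [moll_apply_swap, moll_apply_swap]
  refine integral_congr_ae ?_
  filter_upwards [h] with z hz using by rw [hz]

theorem moll_eq_of_eqOn {v w : Space n → F} {V : Set (Space n)} (h : EqOn v w V) {k : ℕ}
    {x : Space n} (hx : Metric.ball x (bump n k).rOut ⊆ V) : moll k v x = moll k w x := by
  simp only [moll_apply]
  congr 1
  ext z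
  by_cases hz : z ∈ Metric.ball (0 : Space n) (bump n k).rOut
  · rw [h (hx _)]
    simpa [Metric.mem_ball, dist_eq_norm] using hz
  · rw [← (bump n k).support_normed_eq (μ := volume), Function.notMem_support] at hz
    simp [hz]

theorem tendsto_moll_of_continuous [CompleteSpace F] {w : Space n → F} (hw : Continuous w)
    (x : Space n) : Tendsto (fun k => moll k w x) atTop (𝓝 (w x)) :=
  ContDiffBump.convolution_tendsto_right_of_continuous (tendsto_bump_rOut n) hw x

theorem lintegral_ofReal_bump (n k : ℕ) :
    ∫⁻ z, ENNReal.ofReal ((bump n k).normed volume z) = 1 := by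
  rw [← ofReal_integral_eq_lintegral_ofReal (bump n k).integrable_normed
    (Eventually.of_forall fun z => (bump n k).nonneg_normed z), (bump n k).integral_normed,
    ENNReal.ofReal_one]

theorem enorm_moll_sub_le [CompleteSpace F] {w : Space n → F} (hl : LocallyIntegrable w volume)
    (k : ℕ) (x : Space n) : ‖moll k w x - w x‖ₑ ≤
      ∫⁻ z, ENNReal.ofReal ((bump n k).normed volume z) * ‖w (x - z) - w x‖ₑ := by
  have h1 : w x = ∫ z, (bump n k).normed volume z • w x := by
    rw [integral_smul_const, (bump n k).integral_normed, one_smul]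
  have h2 : Integrable (fun z => (bump n k).normed volume z • w x) :=
    (bump n k).integrable_normed.smul_const _
  conv_lhs => rw [h1]
  rw [moll_apply, ← integral_sub (integrable_bump_smul hl k x) h2]
  refine (enorm_integral_le_lintegral_enorm _).trans (le_of_eq (lintegral_congr fun z => ?_))
  rw [← smul_sub, enorm_smul, Real.enorm_of_nonneg ((bump n k).nonneg_normed z)]

theorem tendsto_lintegral_moll_sub [CompleteSpace F] {w : Space n → F} {q : ℕ} (hq : 1 ≤ q)
    (hw : MemLp w q volume) :
    Tendsto (fun k => ∫⁻ x, ‖moll k w x - w x‖ₑ ^ q) atTop (𝓝 0) := by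
  wlog hm : StronglyMeasurable w generalizing w
  · obtain ⟨v, hv, hwv⟩ := hw.1
    have := this (hw.ae_eq hwv) hv
    refine this.congr fun k => lintegral_congr_ae ?_
    filter_upwards [hwv] with x hx
    rw [moll_congr_ae hwv, hx]
  have hl : LocallyIntegrable w volume := hw.locallyIntegrable (by exact_mod_cast hq)
  have key : ∀ k, ∫⁻ x, ‖moll k w x - w x‖ₑ ^ q ≤
      ∫⁻ z, ENNReal.ofReal ((bump n k).normed volume z) * ∫⁻ x, ‖w (x - z) - w x‖ₑ ^ q := by
    intro k
    have hb : Measurable fun z => ENNReal.ofReal ((bump n k).normed volume z) :=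
      (bump n k).continuous_normed.measurable.ennreal_ofReal
    let m : Measure (Space n) :=
      volume.withDensity fun z => ENNReal.ofReal ((bump n k).normed volume z)
    have : IsProbabilityMeasure m := ⟨by simp [m, lintegral_ofReal_bump]⟩
    have hjoint : Measurable fun a : Space n × Space n => ‖w (a.1 - a.2) - w a.1‖ₑ := by
      have h1 : StronglyMeasurable fun a : Space n × Space n => w (a.1 - a.2) :=
        hm.comp_measurable (by fun_prop)
      have h2 : StronglyMeasurable fun a : Space n × Space n => w a.1 :=
        hm.comp_measurable (by fun_prop)
      exact (h1.sub h2).enorm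
    have hconv : ∀ f : Space n → ℝ≥0∞, Measurable f → ∫⁻ z, f z ∂m =
        ∫⁻ z, ENNReal.ofReal ((bump n k).normed volume z) * f z := fun f hf =>
      lintegral_withDensity_eq_lintegral_mul volume hb hf
    calc ∫⁻ x, ‖moll k w x - w x‖ₑ ^ q
        ≤ ∫⁻ x, ∫⁻ z, ENNReal.ofReal ((bump n k).normed volume z) * ‖w (x - z) - w x‖ₑ ^ q := by
          refine lintegral_mono fun x => ?_
          have hx : Measurable fun z => ‖w (x - z) - w x‖ₑ :=
            hjoint.comp measurable_prodMk_left
          calc ‖moll k w x - w x‖ₑ ^ q ≤ (∫⁻ z, ‖w (x - z) - w x‖ₑ ∂m) ^ q := by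
                rw [hconv _ hx]
                gcongr
                exact enorm_moll_sub_le hl k x
            _ ≤ ∫⁻ z, ‖w (x - z) - w x‖ₑ ^ q ∂m := lintegral_pow_le_lintegral_pow hx hq
            _ = _ := hconv _ (hx.pow_const q)
      _ = ∫⁻ z, ∫⁻ x, ENNReal.ofReal ((bump n k).normed volume z) * ‖w (x - z) - w x‖ₑ ^ q := by
          refine lintegral_lintegral_swap ?_
          exact ((hb.comp measurable_snd).mul (hjoint.pow_const q)).aemeasurable
      _ = _ := by
          refine lintegral_congr fun z => ?_
          rw [lintegral_const_mul']
          exact ENNReal.ofReal_ne_top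
  rw [ENNReal.tendsto_nhds_zero]
  intro ε hε
  have h1 := (ENNReal.tendsto_nhds_zero.1 (tendsto_lintegral_translate_sub hq hw)) ε hε
  obtain ⟨r, hr, hball⟩ := Metric.eventually_nhds_iff_ball.1 h1
  filter_upwards [(tendsto_bump_rOut n).eventually (gt_mem_nhds hr)] with k hk
  refine (key k).trans ?_
  calc ∫⁻ z, ENNReal.ofReal ((bump n k).normed volume z) * ∫⁻ x, ‖w (x - z) - w x‖ₑ ^ q
      ≤ ∫⁻ z, ENNReal.ofReal ((bump n k).normed volume z) * ε := by
        refine lintegral_mono fun z => ?_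
        by_cases hz : z ∈ Metric.ball (0 : Space n) (bump n k).rOut
        · gcongr
          exact hball z (Metric.ball_subset_ball hk.le hz)
        · rw [← (bump n k).support_normed_eq (μ := volume), Function.notMem_support] at hz
          simp [hz]
    _ = ε := by
      rw [lintegral_mul_const _ (bump n k).continuous_normed.measurable.ennreal_ofReal,
        lintegral_ofReal_bump, one_mul]

/-- Local `L^q` convergence of mollifications. -/
theorem tendsto_setLIntegral_moll_sub [CompleteSpace F] {w : Space n → F} {q : ℕ} (hq : 1 ≤ q)
    {U V : Set (Space n)} (hU : MeasurableSet U) (hV : MeasurableSet V) {ε : ℝ} (hε : 0 < ε)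
    (hUV : ∀ x ∈ U, Metric.ball x ε ⊆ V) (hw : MemLp w q (volume.restrict V)) :
    Tendsto (fun k => ∫⁻ x in U, ‖moll k w x - w x‖ₑ ^ q) atTop (𝓝 0) := by
  have h0 : MemLp (V.indicator w) (q : ℝ≥0∞) volume := (memLp_indicator_iff_restrict hV).2 hw
  have h1 := tendsto_lintegral_moll_sub hq h0
  refine tendsto_of_tendsto_of_tendsto_of_le_of_le' tendsto_const_nhds h1
    (Eventually.of_forall fun _ => zero_le) ?_
  filter_upwards [(tendsto_bump_rOut n).eventually (gt_mem_nhds hε)] with k hk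
  refine le_trans (le_of_eq ?_) (setLIntegral_le_lintegral U _)
  refine setLIntegral_congr_fun hU fun x hx => ?_
  have hxV : x ∈ V := hUV x hx (Metric.mem_ball_self hε)
  have h2 : moll k w x = moll k (V.indicator w) x :=
    moll_eq_of_eqOn (V := V) (fun y hy => (indicator_of_mem hy w).symm)
      ((Metric.ball_subset_ball hk.le).trans (hUV x hx))
  simp only [h2, indicator_of_mem hxV]

end Mollifier

theorem inner_gradient {n : ℕ} {f : Space n → ℝ} (x v : Space n) :
    inner ℝ (gradient f x) v = fderiv ℝ f x v := by
  simp [gradient]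

theorem continuous_gradient {n : ℕ} {f : Space n → ℝ} (hf : ContDiff ℝ ∞ f) :
    Continuous (gradient f) :=
  (InnerProductSpace.toDual ℝ (Space n)).symm.continuous.comp (hf.continuous_fderiv (by simp))

theorem gradient_sub_apply {n : ℕ} {f g : Space n → ℝ} (hf : ContDiff ℝ ∞ f)
    (hg : ContDiff ℝ ∞ g) (x : Space n) :
    gradient (fun y => f y - g y) x = gradient f x - gradient g x := by
  have h := fderiv_fun_sub (hf.differentiable (by simp) x) (hg.differentiable (by simp) x)
  simp [gradient, h]

/-- Mollification commutes with the weak gradient. -/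
theorem gradient_moll {n : ℕ} {u : Space n → ℝ} {G : Space n → Space n}
    (h : IsWeakGradient u G) (k : ℕ) (x : Space n) : gradient (moll k u) x = moll k G x := by
  have hd := (bump n k).hasCompactSupport_normed.hasFDerivAt_convolution_left (μ := volume)
    (ContinuousLinearMap.lsmul ℝ ℝ) ((bump n k).contDiff_normed (μ := volume) (n := 1)) h.locInt x
  have hφ : ContDiff ℝ ∞ fun z => (bump n k).normed volume (x - z) :=
    ((bump n k).contDiff_normed (μ := volume) (n := ⊤)).comp (contDiff_const.sub contDiff_id)
  have hc : HasCompactSupport fun z => (bump n k).normed volume (x - z) :=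
    ((bump n k).hasCompactSupport_normed (μ := volume)).comp_homeomorph (Homeomorph.subLeft x)
  have hparts := h.by_parts _ hφ hc
  rw [← moll_apply_swap] at hparts
  rw [← neg_inj, ← hparts]
  refine ext_inner_right ℝ fun v => ?_
  have hbd : Differentiable ℝ ((bump n k).normed volume) :=
    ((bump n k).contDiff_normed (μ := volume) (n := 1)).differentiable (by simp)
  have hint : Integrable fun z => (ContinuousLinearMap.precompL (Space n)
      (ContinuousLinearMap.lsmul ℝ ℝ)) (fderiv ℝ ((bump n k).normed volume) (x - z)) (u z) := by
    have := ((bump n k).hasCompactSupport_normed (μ := volume)).fderiv (𝕜 := ℝ) |>.convolutionExists_left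
      (μ := volume)
      (ContinuousLinearMap.precompL (Space n) (ContinuousLinearMap.lsmul ℝ ℝ : ℝ →L[ℝ] ℝ →L[ℝ] ℝ))
      (((bump n k).contDiff_normed (μ := volume) (n := 1)).continuous_fderiv (by simp)) h.locInt x
    simpa using this.integrable_swap
  rw [inner_neg_left, inner_gradient, moll, hd.fderiv, convolution_eq_swap,
    ContinuousLinearMap.integral_apply hint, real_inner_comm,
    ← integral_inner (integrable_smul_gradient h.locInt hφ hc), ← integral_neg]
  refine integral_congr_ae (Eventually.of_forall fun z => ?_)
  have h1 : HasFDerivAt (fun z => (bump n k).normed volume (x - z))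
      ((fderiv ℝ ((bump n k).normed volume) (x - z)).comp (-ContinuousLinearMap.id ℝ (Space n)))
      z := (hbd (x - z)).hasFDerivAt.comp z ((hasFDerivAt_id z).const_sub x)
  simp only [real_inner_smul_right]
  rw [real_inner_comm, inner_gradient, h1.fderiv]
  simp [ContinuousLinearMap.precompL_apply, mul_comm]

theorem IsWeakGradient.ae_eq {n : ℕ} {u : Space n → ℝ} {G H : Space n → Space n}
    (hG : IsWeakGradient u G) (hH : IsWeakGradient u H) : G =ᵐ[volume] H :=
  ae_eq_of_integral_contDiff_smul_eq hG.locInt_grad hH.locInt_grad fun φ hφ hc => by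
    rw [← neg_inj, ← hG.by_parts φ hφ hc, ← hH.by_parts φ hφ hc]

theorem isWeakGradient_weakGrad {n : ℕ} {u : Space n → ℝ} {G : Space n → Space n}
    (hG : IsWeakGradient u G) : IsWeakGradient u (weakGrad u) := by
  have h : ∃ G, IsWeakGradient u G := ⟨G, hG⟩
  rw [weakGrad, dif_pos h]
  exact h.choose_spec

/-- Cauchy-Schwarz for lower integrals. -/
theorem lintegral_mul_sq_le {X : Type*} [MeasurableSpace X] {m : Measure X} {f g : X → ℝ≥0∞}
    (hf : AEMeasurable f m) (hg : AEMeasurable g m) :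
    (∫⁻ x, f x * g x ∂m) ^ 2 ≤ (∫⁻ x, f x ^ 2 ∂m) * ∫⁻ x, g x ^ 2 ∂m := by
  have h := ENNReal.lintegral_mul_le_Lp_mul_Lq m Real.HolderConjugate.two_two hf hg
  simp only [Pi.mul_apply, ENNReal.rpow_two] at h
  have h2 : ∀ x : ℝ≥0∞, (x ^ (1 / 2 : ℝ)) ^ 2 = x := fun x => by
    rw [← ENNReal.rpow_two, ← ENNReal.rpow_mul]; simp
  calc _ ≤ ((∫⁻ x, f x ^ 2 ∂m) ^ (1 / 2 : ℝ) * (∫⁻ x, g x ^ 2 ∂m) ^ (1 / 2 : ℝ)) ^ 2 := by gcongr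
    _ = _ := by rw [mul_pow, h2, h2]

theorem setLIntegral_sq_le {S : Set ℝ} {f : ℝ → ℝ≥0∞} (hf : Measurable f) :
    (∫⁻ r in S, f r) ^ 2 ≤ volume S * ∫⁻ r in S, f r ^ 2 := by
  simpa using lintegral_mul_sq_le (m := volume.restrict S) (f := fun _ => 1) (g := f)
    aemeasurable_const hf.aemeasurable

theorem add_sq_le_two_mul (a b : ℝ≥0∞) : (a + b) ^ 2 ≤ 2 * a ^ 2 + 2 * b ^ 2 := by
  have h := ENNReal.rpow_add_le_mul_rpow_add_rpow a b (p := 2) (by norm_num)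
  norm_num at h
  rwa [mul_add] at h

theorem enorm_add_sq_le {E : Type*} [NormedAddCommGroup E] (a b : E) :
    ‖a + b‖ₑ ^ 2 ≤ 2 * ‖a‖ₑ ^ 2 + 2 * ‖b‖ₑ ^ 2 :=
  (pow_le_pow_left' (enorm_add_le a b) 2).trans (add_sq_le_two_mul _ _)

theorem enorm_sub_sq_le {E : Type*} [NormedAddCommGroup E] (a b c : E) :
    ‖a - c‖ₑ ^ 2 ≤ 2 * ‖a - b‖ₑ ^ 2 + 2 * ‖c - b‖ₑ ^ 2 := by
  have h := enorm_add_sq_le (a - b) (b - c)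
  rwa [sub_add_sub_cancel, enorm_sub_rev b c] at h

theorem tendsto_eLpNorm_two_iff {X F : Type*} [MeasurableSpace X] [NormedAddCommGroup F]
    {m : Measure X} {ι : Type*} {l : Filter ι} (f : ι → X → F) :
    Tendsto (fun k => eLpNorm (f k) 2 m) l (𝓝 0) ↔
      Tendsto (fun k => ∫⁻ x, ‖f k x‖ₑ ^ 2 ∂m) l (𝓝 0) := by
  have e : ∀ k, ∫⁻ x, ‖f k x‖ₑ ^ 2 ∂m = eLpNorm (f k) 2 m ^ 2 := fun k =>
    lintegral_enorm_pow_eq_eLpNorm_pow (f k) (q := 2) (by norm_num)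
  simp only [e]
  constructor
  · intro h
    have := ((ENNReal.continuous_pow 2).tendsto 0).comp h
    rwa [zero_pow two_ne_zero] at this
  · intro h
    have := ((ENNReal.continuous_rpow_const (y := 1 / 2)).tendsto 0).comp h
    simp only [ENNReal.zero_rpow_of_pos (show (0 : ℝ) < 1 / 2 by norm_num)] at this
    refine this.congr fun k => ?_
    simp only [Function.comp_apply, ← ENNReal.rpow_two, ← ENNReal.rpow_mul]
    norm_num

/-- A pointwise bound up to errors tending to zero in `L¹` holds without the errors. -/
theorem ae_le_of_tendsto_lintegral_zero {X : Type*} [MeasurableSpace X] {m : Measure X}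
    {A B : X → ℝ≥0∞} {e : ℕ → X → ℝ≥0∞} (he : ∀ k, Measurable (e k))
    (hAB : ∀ k, ∀ᵐ x ∂m, A x ≤ B x + e k x)
    (hlim : Tendsto (fun k => ∫⁻ x, e k x ∂m) atTop (𝓝 0)) : ∀ᵐ x ∂m, A x ≤ B x := by
  have h1 : ∫⁻ x, liminf (fun k => e k x) atTop ∂m = 0 :=
    le_antisymm ((lintegral_liminf_le he).trans hlim.liminf_eq.le) zero_le
  rw [lintegral_eq_zero_iff (Measurable.liminf he)] at h1
  filter_upwards [h1, ae_all_iff.2 hAB] with x hx hk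
  by_contra! hlt
  have hd : 0 < A x - B x := tsub_pos_of_lt hlt
  have hle : A x - B x ≤ liminf (fun k => e k x) atTop :=
    le_liminf_of_le (by isBoundedDefault)
      (Eventually.of_forall fun k => tsub_le_iff_left.2 (hk k))
  rw [hx] at hle
  exact absurd hle (not_le.2 hd)

/-- Increments of a smooth function along a segment are bounded by the integral of its gradient. -/
theorem enorm_sub_le_lintegral_gradient {n : ℕ} {f : Space n → ℝ} (hf : ContDiff ℝ ∞ f)
    {y e : Space n} (he : ‖e‖ ≤ 1) {a b l l' : ℝ} (hl : l ∈ Ioo a b) (hl' : l' ∈ Ioo a b) :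
    ‖f (y + l • e) - f (y + l' • e)‖ₑ ≤ ∫⁻ r in Ioo a b, ‖gradient f (y + r • e)‖ₑ := by
  wlog h : l' ≤ l generalizing l l'
  · rw [enorm_sub_rev]
    exact this hl' hl (le_of_not_ge h)
  have hd : ∀ r, HasDerivAt (fun r : ℝ => f (y + r • e)) (inner ℝ (gradient f (y + r • e)) e) r := by
    intro r
    rw [inner_gradient]
    have h1 : HasDerivAt (fun r : ℝ => y + r • e) e r := by
      simpa using ((hasDerivAt_id r).smul_const e).const_add y
    exact (hf.differentiable (by simp) _).hasFDerivAt.comp_hasDerivAt r h1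
  have hc : Continuous fun r : ℝ => inner ℝ (gradient f (y + r • e)) e :=
    ((continuous_gradient hf).comp (by fun_prop)).inner continuous_const
  rw [← intervalIntegral.integral_eq_sub_of_hasDerivAt (fun r _ => hd r)
    (hc.intervalIntegrable _ _), intervalIntegral.integral_of_le h]
  refine (enorm_integral_le_lintegral_enorm _).trans ?_
  calc _ ≤ ∫⁻ r in Ioc l' l, ‖gradient f (y + r • e)‖ₑ := by
        refine lintegral_mono fun r => ?_
        rw [enorm_le_iff_norm_le]
        exact (norm_inner_le_norm _ _).trans (mul_le_of_le_one_right (norm_nonneg _) he)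
    _ ≤ _ := lintegral_mono_set
        (show Ioc l' l ⊆ Ioo a b from fun _ hr => ⟨hl'.1.trans hr.1, hr.2.trans_lt hl.2⟩)

/-- A compact set `Γ` with a finite measure `μ` and a field `ν` of transversal directions, along
which the space near `Γ` can be integrated by slices. -/
structure IsNormalTube {n : ℕ} (Γ : Set (Space n)) (μ : Measure (Space n))
    (ν : Space n → Space n) (ρ κ : ℝ) (C : ℝ≥0∞) : Prop where
  compact : IsCompact Γ
  nonempty : Γ.Nonempty
  finite : IsFiniteMeasure μ
  ae_mem : ∀ᵐ y ∂μ, y ∈ Γ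
  measurable : Measurable ν
  continuousOn : ContinuousOn ν Γ
  norm_le : ∀ y ∈ Γ, ‖ν y‖ ≤ 1
  radius_pos : 0 < ρ
  ratio_pos : 0 < κ
  le_infDist : ∀ y ∈ Γ, ∀ r : ℝ, |r| < ρ → κ * |r| ≤ Metric.infDist (y + r • ν y) Γ
  const_ne_top : C ≠ ⊤
  lintegral_le : ∀ F : Space n → ℝ≥0∞, Measurable F →
    ∫⁻ y, (∫⁻ r in Ioo (-ρ) ρ, F (y + r • ν y)) ∂μ ≤ C * ∫⁻ x, F x

namespace IsNormalTube

variable {n : ℕ} {Γ : Set (Space n)} {μ : Measure (Space n)} {ν : Space n → Space n} {ρ κ : ℝ}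
  {C : ℝ≥0∞}

theorem mono (h : IsNormalTube Γ μ ν ρ κ C) {ρ' : ℝ} (h0 : 0 < ρ') (hρ : ρ' ≤ ρ) :
    IsNormalTube Γ μ ν ρ' κ C :=
  { h with
    radius_pos := h0
    le_infDist := fun y hy r hr => h.le_infDist y hy r (hr.trans_le hρ)
    lintegral_le := fun F hF => le_trans
      (lintegral_mono fun _ => lintegral_mono_set (Ioo_subset_Ioo (neg_le_neg hρ) hρ))
      (h.lintegral_le F hF) }

theorem measurable_slice (h : IsNormalTube Γ μ ν ρ κ C) :
    Measurable fun p : Space n × ℝ => p.1 + p.2 • ν p.1 := by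
  have := h.measurable
  fun_prop

theorem measurable_parallel (h : IsNormalTube Γ μ ν ρ κ C) (l : ℝ) : Measurable (parallel ν l) :=
  h.measurable_slice.comp (measurable_id.prodMk measurable_const)

theorem measurable_setLIntegral (h : IsNormalTube Γ μ ν ρ κ C) {F : Space n → ℝ≥0∞}
    (hF : Measurable F) (J : Set ℝ) : Measurable fun y => ∫⁻ r in J, F (y + r • ν y) :=
  (hF.comp h.measurable_slice).lintegral_prod_right'

theorem lintegral_slice_le (h : IsNormalTube Γ μ ν ρ κ C) {V : Set (Space n)}
    (hV : MeasurableSet V) {J : Set ℝ} (hJm : MeasurableSet J) (hJ : J ⊆ Ioo (-ρ) ρ)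
    (hJV : ∀ y ∈ Γ, ∀ r ∈ J, y + r • ν y ∈ V) {F : Space n → ℝ≥0∞} (hF : Measurable F) :
    ∫⁻ y, (∫⁻ r in J, F (y + r • ν y)) ∂μ ≤ C * ∫⁻ x in V, F x := by
  rw [← lintegral_indicator hV]
  refine le_trans (lintegral_mono_ae ?_) (h.lintegral_le _ (hF.indicator hV))
  filter_upwards [h.ae_mem] with y hy
  refine le_trans (le_of_eq (setLIntegral_congr_fun hJm fun r hr => ?_)) (lintegral_mono_set hJ)
  simp only [indicator_of_mem (hJV y hy r hr)]

theorem infDist_le (h : IsNormalTube Γ μ ν ρ κ C) {y : Space n} (hy : y ∈ Γ) (r : ℝ) :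
    Metric.infDist (y + r • ν y) Γ ≤ |r| := by
  refine (Metric.infDist_le_dist_of_mem hy).trans ?_
  rw [dist_eq_norm, add_sub_cancel_left, norm_smul, Real.norm_eq_abs]
  exact mul_le_of_le_one_right (abs_nonneg r) (h.norm_le y hy)

theorem continuousOn_parallel (h : IsNormalTube Γ μ ν ρ κ C) (l : ℝ) :
    ContinuousOn (parallel ν l) Γ :=
  continuousOn_id.add (h.continuousOn.const_smul l)

theorem exists_thickness (h : IsNormalTube Γ μ ν ρ κ C) {l : ℝ} (hl : |l| < ρ)
    {V : Set (Space n)} (hV : IsOpen V) (hlV : ∀ y ∈ Γ, parallel ν l y ∈ V) :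
    ∃ η : ℝ, 0 < η ∧ Ioo (l - η) (l + η) ⊆ Ioo (-ρ) ρ ∧
      ∀ y ∈ Γ, ∀ r ∈ Ioo (l - η) (l + η), y + r • ν y ∈ V := by
  obtain ⟨ε, hε, hsub⟩ := (h.compact.image_of_continuousOn
    (h.continuousOn_parallel l)).exists_thickening_subset_open hV (image_subset_iff.2 hlV)
  refine ⟨min ε (ρ - |l|), lt_min hε (sub_pos.2 hl), ?_, ?_⟩
  · have := abs_le.1 (le_refl |l|)
    have h2 := min_le_right ε (ρ - |l|)
    exact Ioo_subset_Ioo (by linarith) (by linarith)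
  · intro y hy r hr
    refine hsub (Metric.mem_thickening_iff.2 ⟨_, mem_image_of_mem _ hy, ?_⟩)
    rw [parallel, dist_eq_norm, add_sub_add_left_eq_sub, ← sub_smul, norm_smul]
    refine (mul_le_of_le_one_right (norm_nonneg _) (h.norm_le y hy)).trans_lt ?_
    rw [Real.norm_eq_abs, abs_lt]
    have h2 := min_le_left ε (ρ - |l|)
    constructor <;> linarith [hr.1, hr.2]

/-- The trace inequality on parallel sets for smooth functions. -/
theorem exists_trace_inequality (h : IsNormalTube Γ μ ν ρ κ C) {l : ℝ} (hl : |l| < ρ)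
    {V : Set (Space n)} (hV : IsOpen V) (hlV : ∀ y ∈ Γ, parallel ν l y ∈ V) :
    ∃ K : ℝ≥0∞, K ≠ ⊤ ∧ ∀ f : Space n → ℝ, ContDiff ℝ ∞ f →
      ∫⁻ y, ‖f (parallel ν l y)‖ₑ ^ 2 ∂μ ≤
        K * ((∫⁻ x in V, ‖f x‖ₑ ^ 2) + ∫⁻ x in V, ‖gradient f x‖ₑ ^ 2) := by
  obtain ⟨η, hη, hsub, hηV⟩ := h.exists_thickness hl hV hlV
  set J := Ioo (l - η) (l + η) with hJ
  have hlJ : l ∈ J := ⟨by linarith, by linarith⟩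
  set a : ℝ≥0∞ := volume J with ha
  have hav : a = ENNReal.ofReal (2 * η) := by
    rw [ha, hJ, Real.volume_Ioo]; congr 1; ring
  have ha0 : a ≠ 0 := by rw [hav]; simpa using hη
  have hat : a ≠ ⊤ := by rw [hav]; exact ENNReal.ofReal_ne_top
  have hCt := h.const_ne_top
  refine ⟨a⁻¹ * (2 * C + 2 * a * a * C), ?_, fun f hf => ?_⟩
  · have : a⁻¹ ≠ ⊤ := ENNReal.inv_ne_top.2 ha0
    finiteness
  have hfm : Measurable fun x => ‖f x‖ₑ ^ 2 := hf.continuous.measurable.enorm.pow_const 2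
  have hgm : Measurable fun x => ‖gradient f x‖ₑ := (continuous_gradient hf).measurable.enorm
  have key : ∀ y ∈ Γ, a * ‖f (parallel ν l y)‖ₑ ^ 2 ≤
      2 * (∫⁻ r in J, ‖f (y + r • ν y)‖ₑ ^ 2) +
        2 * a * a * ∫⁻ r in J, ‖gradient f (y + r • ν y)‖ₑ ^ 2 := by
    intro y hy
    have hline : Measurable fun r : ℝ => y + r • ν y := by fun_prop
    set B := ∫⁻ r in J, ‖gradient f (y + r • ν y)‖ₑ with hB
    have hB2 : B ^ 2 ≤ a * ∫⁻ r in J, ‖gradient f (y + r • ν y)‖ₑ ^ 2 :=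
      setLIntegral_sq_le (hgm.comp hline)
    calc a * ‖f (parallel ν l y)‖ₑ ^ 2 = ∫⁻ r in J, ‖f (parallel ν l y)‖ₑ ^ 2 := by
          rw [setLIntegral_const, mul_comm]
      _ ≤ ∫⁻ r in J, (2 * ‖f (y + r • ν y)‖ₑ ^ 2 + 2 * B ^ 2) := by
          refine setLIntegral_mono' measurableSet_Ioo fun r hr => ?_
          refine le_trans ?_ (add_sq_le_two_mul _ _)
          gcongr
          have h1 := enorm_sub_le_lintegral_gradient hf (y := y) (h.norm_le y hy) hlJ hr
          have h2 := enorm_add_le (f (y + r • ν y)) (f (y + l • ν y) - f (y + r • ν y))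
          rw [add_sub_cancel] at h2
          exact h2.trans (by gcongr)
      _ = 2 * (∫⁻ r in J, ‖f (y + r • ν y)‖ₑ ^ 2) + 2 * a * B ^ 2 := by
          rw [lintegral_add_right _ measurable_const, setLIntegral_const,
            lintegral_const_mul _ (show Measurable fun r => ‖f (y + r • ν y)‖ₑ ^ 2 from hfm.comp hline)]
          ring
      _ ≤ _ := by
          rw [mul_assoc (2 * a) a]
          gcongr
  have hs1 := h.lintegral_slice_le hV.measurableSet measurableSet_Ioo hsub hηV hfm
  have hs2 := h.lintegral_slice_le hV.measurableSet measurableSet_Ioo hsub hηV (hgm.pow_const 2)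
  have hmp : Measurable fun y => ‖f (parallel ν l y)‖ₑ ^ 2 := hfm.comp (h.measurable_parallel l)
  rw [mul_assoc, ← ENNReal.mul_le_iff_le_inv ha0 hat, ← lintegral_const_mul _ hmp]
  calc ∫⁻ y, a * ‖f (parallel ν l y)‖ₑ ^ 2 ∂μ
      ≤ ∫⁻ y, (2 * (∫⁻ r in J, ‖f (y + r • ν y)‖ₑ ^ 2) +
        2 * a * a * ∫⁻ r in J, ‖gradient f (y + r • ν y)‖ₑ ^ 2) ∂μ :=
        lintegral_mono_ae (h.ae_mem.mono key)
    _ ≤ 2 * (C * ∫⁻ x in V, ‖f x‖ₑ ^ 2) + 2 * a * a * (C * ∫⁻ x in V, ‖gradient f x‖ₑ ^ 2) := by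
        rw [lintegral_add_left ((h.measurable_setLIntegral hfm J).const_mul 2),
          lintegral_const_mul _ (h.measurable_setLIntegral hfm J),
          lintegral_const_mul _ (h.measurable_setLIntegral (hgm.pow_const 2) J)]
        gcongr
    _ ≤ _ := by
        rw [add_mul, mul_add, mul_add]
        calc _ ≤ 2 * C * (∫⁻ x in V, ‖f x‖ₑ ^ 2) +
              2 * a * a * C * ∫⁻ x in V, ‖gradient f x‖ₑ ^ 2 := by
              simp only [mul_assoc]; exact le_rfl
          _ ≤ _ := add_le_add le_self_add le_add_self

end IsNormalTube

section SquareIntegrals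

variable {X F : Type*} [MeasurableSpace X] [NormedAddCommGroup F] {m : Measure X}

theorem lintegral_enorm_sub_sq_le {f g h : X → F} (hm : AEStronglyMeasurable (fun x => h x - g x) m) :
    ∫⁻ x, ‖f x - h x‖ₑ ^ 2 ∂m ≤
      2 * (∫⁻ x, ‖f x - g x‖ₑ ^ 2 ∂m) + 2 * ∫⁻ x, ‖h x - g x‖ₑ ^ 2 ∂m := by
  calc _ ≤ ∫⁻ x, (2 * ‖f x - g x‖ₑ ^ 2 + 2 * ‖h x - g x‖ₑ ^ 2) ∂m :=
        lintegral_mono fun x => enorm_sub_sq_le _ _ _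
    _ = _ := by
      rw [lintegral_add_right' _ ((hm.enorm.pow_const 2).const_mul 2),
        lintegral_const_mul' _ _ (by simp), lintegral_const_mul' _ _ (by simp)]

theorem lintegral_enorm_sq_le {f g : X → F} (hm : AEStronglyMeasurable g m) :
    ∫⁻ x, ‖f x‖ₑ ^ 2 ∂m ≤
      2 * (∫⁻ x, ‖f x - g x‖ₑ ^ 2 ∂m) + 2 * ∫⁻ x, ‖g x‖ₑ ^ 2 ∂m := by
  simpa using lintegral_enorm_sub_sq_le (f := f) (g := g) (h := fun _ => 0) (m := m)
    (by simp only [zero_sub]; exact hm.neg)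

theorem tendsto_two_mul_add_two_mul {ι : Type*} {l : Filter ι} {a b : ι → ℝ≥0∞}
    (ha : Tendsto a l (𝓝 0)) (hb : Tendsto b l (𝓝 0)) :
    Tendsto (fun k => 2 * a k + 2 * b k) l (𝓝 0) := by
  simpa using (ENNReal.Tendsto.const_mul (a := 2) ha (Or.inr (by simp))).add
    (ENNReal.Tendsto.const_mul (a := 2) hb (Or.inr (by simp)))

theorem Lp_edist_sq (g h : Lp F 2 m) : edist g h ^ 2 = ∫⁻ x, ‖g x - h x‖ₑ ^ 2 ∂m := by
  have := lintegral_enorm_pow_eq_eLpNorm_pow (m := m) (fun x => g x - h x) (q := 2) (by norm_num)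
  rw [this, Lp.edist_def]
  rfl

/-- A sequence that is Cauchy in mean square converges in mean square. -/
theorem exists_tendsto_lintegral_sub_sq [CompleteSpace F] {f : ℕ → X → F}
    (hf : ∀ k, MemLp (f k) 2 m) {b : ℕ → ℝ≥0∞} (hb : Tendsto b atTop (𝓝 0))
    (hfb : ∀ j k, ∫⁻ x, ‖f j x - f k x‖ₑ ^ 2 ∂m ≤ b j + b k) :
    ∃ g : Lp F 2 m, Tendsto (fun k => ∫⁻ x, ‖f k x - g x‖ₑ ^ 2 ∂m) atTop (𝓝 0) := by
  have hd : ∀ k (g : Lp F 2 m),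
      ∫⁻ x, ‖f k x - g x‖ₑ ^ 2 ∂m = edist ((hf k).toLp (f k)) g ^ 2 := fun k g => by
    rw [Lp_edist_sq]
    refine lintegral_congr_ae ?_
    filter_upwards [(hf k).coeFn_toLp] with x hx using by rw [hx]
  have hcau : CauchySeq fun k => (hf k).toLp (f k) := by
    rw [EMetric.cauchySeq_iff]
    intro ε hε
    have h2 : (0 : ℝ≥0∞) < ε ^ 2 / 2 := ENNReal.div_pos (pow_ne_zero 2 hε.ne') (by simp)
    obtain ⟨N, hN⟩ := eventually_atTop.1 (hb.eventually (gt_mem_nhds h2))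
    refine ⟨N, fun j hj k hk => ?_⟩
    have h3 : edist ((hf j).toLp (f j)) ((hf k).toLp (f k)) ^ 2 < ε ^ 2 := by
      rw [← hd]
      calc ∫⁻ x, ‖f j x - (hf k).toLp (f k) x‖ₑ ^ 2 ∂m = ∫⁻ x, ‖f j x - f k x‖ₑ ^ 2 ∂m := by
            refine lintegral_congr_ae ?_
            filter_upwards [(hf k).coeFn_toLp] with x hx using by rw [hx]
        _ ≤ b j + b k := hfb j k
        _ < ε ^ 2 / 2 + ε ^ 2 / 2 := ENNReal.add_lt_add (hN j hj) (hN k hk)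
        _ = ε ^ 2 := ENNReal.add_halves _
    exact lt_of_pow_lt_pow_left' 2 h3
  obtain ⟨g, hg⟩ := cauchySeq_tendsto_of_complete hcau
  refine ⟨g, ?_⟩
  simp only [hd]
  have := ((ENNReal.continuous_pow 2).tendsto 0).comp (tendsto_iff_edist_tendsto_0.1 hg)
  rwa [zero_pow two_ne_zero] at this

/-- Mean square limits of asymptotically equal sequences agree. -/
theorem Lp_eq_of_tendsto {ι : Type*} {l : Filter ι} [l.NeBot] {f f' : ι → X → F} {g g' : Lp F 2 m}
    (hf : ∀ k, AEStronglyMeasurable (f k) m) (hf' : ∀ k, AEStronglyMeasurable (f' k) m)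
    (h : Tendsto (fun k => ∫⁻ x, ‖f k x - g x‖ₑ ^ 2 ∂m) l (𝓝 0))
    (h' : Tendsto (fun k => ∫⁻ x, ‖f' k x - g' x‖ₑ ^ 2 ∂m) l (𝓝 0))
    (hff' : Tendsto (fun k => ∫⁻ x, ‖f k x - f' k x‖ₑ ^ 2 ∂m) l (𝓝 0)) : g = g' := by
  have h1 := tendsto_two_mul_add_two_mul (tendsto_two_mul_add_two_mul h hff') h'
  have h2 : edist g g' ^ 2 ≤ 0 := by
    refine ge_of_tendsto h1 (Eventually.of_forall fun k => ?_)
    rw [Lp_edist_sq]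
    have a1 := lintegral_enorm_sub_sq_le (f := g) (g := f' k) (h := g')
      ((Lp.aestronglyMeasurable g').sub (hf' k))
    have a2 := lintegral_enorm_sub_sq_le (f := g) (g := f k) (h := f' k)
      ((hf' k).sub (hf k))
    simp only [enorm_sub_rev (g _) (f k _), enorm_sub_rev (f' k _) (f k _),
      enorm_sub_rev (g' _) (f' k _)] at a1 a2
    exact a1.trans (by gcongr)
  rw [nonpos_iff_eq_zero, pow_eq_zero_iff two_ne_zero, edist_eq_zero] at h2
  exact h2

theorem tendsto_lintegral_enorm_of_sq [IsFiniteMeasure m] {ι : Type*} {l : Filter ι} {f : ι → X → F}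
    (hf : ∀ k, AEStronglyMeasurable (f k) m)
    (h : Tendsto (fun k => ∫⁻ x, ‖f k x‖ₑ ^ 2 ∂m) l (𝓝 0)) :
    Tendsto (fun k => ∫⁻ x, ‖f k x‖ₑ ∂m) l (𝓝 0) := by
  have h1 : ∀ k, (∫⁻ x, ‖f k x‖ₑ ∂m) ^ 2 ≤ m univ * ∫⁻ x, ‖f k x‖ₑ ^ 2 ∂m := fun k => by
    simpa using lintegral_mul_sq_le (m := m) (f := fun _ => 1) aemeasurable_const (hf k).enorm
  have h2 : Tendsto (fun k => (∫⁻ x, ‖f k x‖ₑ ∂m) ^ 2) l (𝓝 0) := by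
    refine tendsto_of_tendsto_of_tendsto_of_le_of_le tendsto_const_nhds ?_
      (fun _ => zero_le) h1
    simpa using ENNReal.Tendsto.const_mul (a := m univ) h (Or.inr (measure_ne_top m univ))
  have h3 := ((ENNReal.continuous_rpow_const (y := 1 / 2)).tendsto 0).comp h2
  simp only [ENNReal.zero_rpow_of_pos (show (0 : ℝ) < 1 / 2 by norm_num)] at h3
  refine h3.congr fun k => ?_
  simp only [Function.comp_apply, ← ENNReal.rpow_two, ← ENNReal.rpow_mul]
  norm_num

end SquareIntegrals

/-- `G` is the weak gradient of `u`, and `E` bounds the integrals of `u²` and `d(·,Γ)^s |G|²` over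
the `δ`-neighbourhood of `Γ`. -/
structure HasEnergyNear {n : ℕ} (Γ : Set (Space n)) (s δ : ℝ) (u : Space n → ℝ)
    (G : Space n → Space n) (E : ℝ≥0∞) : Prop where
  weak : IsWeakGradient u G
  ne_top : E ≠ ⊤
  sq_le : ∫⁻ x in {x | Metric.infDist x Γ < δ}, ‖u x‖ₑ ^ 2 ≤ E
  grad_le : ∫⁻ x in {x | Metric.infDist x Γ < δ},
    ENNReal.ofReal (Metric.infDist x Γ ^ s) * ‖G x‖ₑ ^ 2 ≤ E

theorem memLp_two_of_lintegral {X F : Type*} [MeasurableSpace X] [NormedAddCommGroup F]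
    {m : Measure X} {f : X → F} (hf : AEStronglyMeasurable f m)
    (h : ∫⁻ x, ‖f x‖ₑ ^ 2 ∂m ≠ ⊤) : MemLp f (2 : ℕ) m := by
  refine ⟨hf, ?_⟩
  rw [lintegral_enorm_pow_eq_eLpNorm_pow f (q := 2) (by norm_num)] at h
  exact lt_top_iff_ne_top.2 fun h2 => h (by rw [h2]; simp)

/-- The part of the `b`-neighbourhood of `Γ` at distance more than `a` from `Γ`. -/
def shell {n : ℕ} (Γ : Set (Space n)) (a b : ℝ) : Set (Space n) :=
  {x | a < Metric.infDist x Γ ∧ Metric.infDist x Γ < b}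

theorem isOpen_shell {n : ℕ} (Γ : Set (Space n)) (a b : ℝ) : IsOpen (shell Γ a b) :=
  (isOpen_lt continuous_const (Metric.continuous_infDist_pt Γ)).inter
    (isOpen_lt (Metric.continuous_infDist_pt Γ) continuous_const)

namespace HasEnergyNear

variable {n : ℕ} {Γ : Set (Space n)} {s δ : ℝ} {u : Space n → ℝ} {G : Space n → Space n} {E : ℝ≥0∞}

theorem lintegral_shell_le (h : HasEnergyNear Γ s δ u G E) (a : ℝ) :
    ∫⁻ x in shell Γ a δ, ‖u x‖ₑ ^ 2 ≤ E :=
  (lintegral_mono_set fun _ hx => hx.2).trans h.sq_le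

theorem lintegral_grad_shell_le (h : HasEnergyNear Γ s δ u G E) (hs : 0 ≤ s) {a : ℝ} (ha : 0 < a) :
    ∫⁻ x in shell Γ a δ, ‖G x‖ₑ ^ 2 ≤ (ENNReal.ofReal (a ^ s))⁻¹ * E := by
  have h0 : ENNReal.ofReal (a ^ s) ≠ 0 := by simpa using Real.rpow_pos_of_pos ha s
  rw [← ENNReal.mul_le_iff_le_inv h0 ENNReal.ofReal_ne_top,
    ← lintegral_const_mul' _ _ ENNReal.ofReal_ne_top]
  refine le_trans (setLIntegral_mono' (isOpen_shell Γ a δ).measurableSet fun x hx => ?_)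
    ((lintegral_mono_set (show shell Γ a δ ⊆ _ from fun _ hx => hx.2)).trans h.grad_le)
  gcongr
  exact hx.1.le

theorem tendsto_moll_shell (h : HasEnergyNear Γ s δ u G E) (hs : 0 ≤ s) {a ρ : ℝ} (ha : 0 < a)
    (hρ : ρ < δ) :
    Tendsto (fun k => ∫⁻ x in shell Γ a ρ, ‖moll k u x - u x‖ₑ ^ 2) atTop (𝓝 0) ∧
      Tendsto (fun k => ∫⁻ x in shell Γ a ρ, ‖moll k G x - G x‖ₑ ^ 2) atTop (𝓝 0) := by
  have ha2 : 0 < a / 2 := by positivity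
  have hε : 0 < min (a / 2) (δ - ρ) := lt_min ha2 (by linarith)
  have hball : ∀ x ∈ shell Γ a ρ, Metric.ball x (min (a / 2) (δ - ρ)) ⊆ shell Γ (a / 2) δ := by
    intro x hx y hy
    have h1 := Metric.infDist_le_infDist_add_dist (s := Γ) (x := x) (y := y)
    have h2 := Metric.infDist_le_infDist_add_dist (s := Γ) (x := y) (y := x)
    have h3 := lt_min_iff.1 (Metric.mem_ball.1 hy)
    rw [dist_comm] at h1
    exact ⟨by linarith [hx.1], by linarith [hx.2]⟩
  have hE := h.ne_top
  have h0 : ENNReal.ofReal ((a / 2) ^ s) ≠ 0 := by simpa using Real.rpow_pos_of_pos ha2 s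
  refine ⟨tendsto_setLIntegral_moll_sub (q := 2) (by norm_num) (isOpen_shell _ _ _).measurableSet
      (isOpen_shell _ _ _).measurableSet hε hball ?_,
    tendsto_setLIntegral_moll_sub (q := 2) (by norm_num) (isOpen_shell _ _ _).measurableSet
      (isOpen_shell _ _ _).measurableSet hε hball ?_⟩
  · exact memLp_two_of_lintegral h.weak.locInt.aestronglyMeasurable.restrict
      (ne_top_of_le_ne_top hE (h.lintegral_shell_le _))
  · refine memLp_two_of_lintegral h.weak.locInt_grad.aestronglyMeasurable.restrict
      (ne_top_of_le_ne_top ?_ (h.lintegral_grad_shell_le hs ha2))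
    exact ENNReal.mul_ne_top (ENNReal.inv_ne_top.2 h0) hE

end HasEnergyNear

namespace IsNormalTube

variable {n : ℕ} {Γ : Set (Space n)} {μ : Measure (Space n)} {ν : Space n → Space n} {ρ κ : ℝ}
  {C : ℝ≥0∞} {s δ : ℝ} {u : Space n → ℝ} {G : Space n → Space n} {E : ℝ≥0∞}

theorem parallel_mem_shell (h : IsNormalTube Γ μ ν ρ κ C) {l : ℝ} (h0 : 0 < |l|) (hl : |l| < ρ)
    {y : Space n} (hy : y ∈ Γ) : parallel ν l y ∈ shell Γ (κ * |l| / 2) ρ := by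
  have := mul_pos h.ratio_pos h0
  exact ⟨(half_lt_self this).trans_le (h.le_infDist y hy l hl), (h.infDist_le hy l).trans_lt hl⟩

theorem memLp_comp_parallel (h : IsNormalTube Γ μ ν ρ κ C) (l : ℝ) {f : Space n → ℝ}
    (hf : Continuous f) : MemLp (fun y => f (parallel ν l y)) 2 μ := by
  have := h.finite
  obtain ⟨M, hM⟩ := h.compact.exists_bound_of_continuousOn
    (hf.comp_continuousOn (h.continuousOn_parallel l))
  exact MemLp.of_bound (hf.measurable.comp (h.measurable_parallel l)).aestronglyMeasurable M
    (h.ae_mem.mono hM)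

/-- The traces on a parallel set of the mollifications of `u` converge in mean square. -/
theorem exists_tendsto_moll_parallel (h : IsNormalTube Γ μ ν ρ κ C) (hs : 0 ≤ s) (hρ : ρ < δ)
    (hE : HasEnergyNear Γ s δ u G E) {l : ℝ} (h0 : 0 < |l|) (hl : |l| < ρ) :
    ∃ g : Lp ℝ 2 μ,
      Tendsto (fun k => ∫⁻ y, ‖moll k u (parallel ν l y) - g y‖ₑ ^ 2 ∂μ) atTop (𝓝 0) := by
  have ha : 0 < κ * |l| / 2 := by have := mul_pos h.ratio_pos h0; positivity
  obtain ⟨hu, hG⟩ := hE.tendsto_moll_shell hs ha hρ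
  set U := shell Γ (κ * |l| / 2) ρ
  obtain ⟨K, hK, hTI⟩ := h.exists_trace_inequality hl (isOpen_shell Γ (κ * |l| / 2) ρ)
    fun y hy => h.parallel_mem_shell h0 hl hy
  have hsm : ∀ k, ContDiff ℝ ∞ (moll k u) := contDiff_moll hE.weak.locInt
  have hb := ENNReal.Tendsto.const_mul (a := K) (tendsto_two_mul_add_two_mul hu hG) (Or.inr hK)
  rw [mul_zero] at hb
  refine exists_tendsto_lintegral_sub_sq
    (fun k => h.memLp_comp_parallel l (hsm k).continuous) hb fun j k => ?_
  refine (hTI (fun x => moll j u x - moll k u x) ((hsm j).sub (hsm k))).trans ?_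
  rw [← mul_add]
  gcongr K * ?_
  have hum : AEStronglyMeasurable u (volume.restrict U) :=
    hE.weak.locInt.aestronglyMeasurable.restrict
  have hGm : AEStronglyMeasurable G (volume.restrict U) :=
    hE.weak.locInt_grad.aestronglyMeasurable.restrict
  have e1 := lintegral_enorm_sub_sq_le (m := volume.restrict U) (f := moll j u) (g := u)
    (h := moll k u) ((hsm k).continuous.aestronglyMeasurable.sub hum)
  have hGk : AEStronglyMeasurable (moll k G) (volume.restrict U) := by
    rw [← funext (gradient_moll hE.weak k)]
    exact (continuous_gradient (hsm k)).aestronglyMeasurable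
  have e2 := lintegral_enorm_sub_sq_le (m := volume.restrict U) (f := moll j G) (g := G)
    (h := moll k G) (hGk.sub hGm)
  simp only [gradient_sub_apply (hsm j) (hsm k), gradient_moll hE.weak]
  refine (add_le_add e1 e2).trans (le_of_eq ?_)
  ring

theorem exists_trace_bound (h : IsNormalTube Γ μ ν ρ κ C) (hs : 0 ≤ s) (hρ : ρ < δ)
    {l : ℝ} (h0 : 0 < |l|) (hl : |l| < ρ) :
    ∃ K : ℝ≥0∞, K ≠ ⊤ ∧ ∀ (u : Space n → ℝ) (G : Space n → Space n) (E : ℝ≥0∞) (g : Lp ℝ 2 μ),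
      HasEnergyNear Γ s δ u G E →
      Tendsto (fun k => ∫⁻ y, ‖moll k u (parallel ν l y) - g y‖ₑ ^ 2 ∂μ) atTop (𝓝 0) →
      ∫⁻ y, ‖g y‖ₑ ^ 2 ∂μ ≤ K * E := by
  have ha : 0 < κ * |l| / 2 := by have := mul_pos h.ratio_pos h0; positivity
  obtain ⟨K, hK, hTI⟩ := h.exists_trace_inequality hl (isOpen_shell Γ (κ * |l| / 2) ρ)
    fun y hy => h.parallel_mem_shell h0 hl hy
  set c := (ENNReal.ofReal ((κ * |l| / 2) ^ s))⁻¹ with hc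
  have hct : c ≠ ⊤ := ENNReal.inv_ne_top.2 (by simpa using Real.rpow_pos_of_pos ha s)
  refine ⟨2 * (K * (2 + 2 * c)), by finiteness, fun u G E g hE hg => ?_⟩
  obtain ⟨hu, hG⟩ := hE.tendsto_moll_shell hs ha hρ
  set U := shell Γ (κ * |l| / 2) ρ with hU
  have hUδ : U ⊆ shell Γ (κ * |l| / 2) δ := fun x hx => ⟨hx.1, hx.2.trans hρ⟩
  have hsm : ∀ k, ContDiff ℝ ∞ (moll k u) := contDiff_moll hE.weak.locInt
  have hum : AEStronglyMeasurable u (volume.restrict U) :=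
    hE.weak.locInt.aestronglyMeasurable.restrict
  have hGm : AEStronglyMeasurable G (volume.restrict U) :=
    hE.weak.locInt_grad.aestronglyMeasurable.restrict
  have hK0 := ENNReal.Tendsto.const_mul (a := K) (tendsto_two_mul_add_two_mul hu hG) (Or.inr hK)
  rw [mul_zero] at hK0
  have hlim := tendsto_two_mul_add_two_mul hg hK0
  have hlim2 := hlim.add_const (2 * (K * (2 + 2 * c)) * E)
  rw [zero_add] at hlim2
  refine ge_of_tendsto hlim2 (Eventually.of_forall fun k => ?_)
  have e0 := lintegral_enorm_sq_le (m := μ) (f := g) (g := fun y => moll k u (parallel ν l y))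
    (h.memLp_comp_parallel l (hsm k).continuous).1
  simp only [enorm_sub_rev (g _)] at e0
  have e1 := lintegral_enorm_sq_le (m := volume.restrict U) (f := moll k u) hum
  have e2 := lintegral_enorm_sq_le (m := volume.restrict U) (f := moll k G) hGm
  have e3 := hTI _ (hsm k)
  simp only [gradient_moll hE.weak] at e3
  have e4 : ∫⁻ x in U, ‖u x‖ₑ ^ 2 ≤ E := (lintegral_mono_set hUδ).trans (hE.lintegral_shell_le _)
  have e5 : ∫⁻ x in U, ‖G x‖ₑ ^ 2 ≤ c * E :=
    (lintegral_mono_set hUδ).trans (hE.lintegral_grad_shell_le hs ha)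
  set A := ∫⁻ x in U, ‖moll k u x - u x‖ₑ ^ 2
  set B := ∫⁻ x in U, ‖moll k G x - G x‖ₑ ^ 2
  calc _ ≤ _ := e0
    _ ≤ 2 * (∫⁻ y, ‖moll k u (parallel ν l y) - g y‖ₑ ^ 2 ∂μ) +
        2 * (K * ((2 * A + 2 * E) + (2 * B + 2 * (c * E)))) := by
        gcongr
        refine e3.trans ?_
        gcongr
        · exact e1.trans (by gcongr)
        · exact e2.trans (by gcongr)
    _ = _ := by ring

/-- The limit of the mollifications is the only trace of `u` on a parallel set. -/
theorem isTraceAlong_iff (h : IsNormalTube Γ μ ν ρ κ C) (hs : 0 ≤ s) (hρ : ρ < δ)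
    (hE : HasEnergyNear Γ s δ u (weakGrad u) E) {l : ℝ} (h0 : 0 < |l|) (hl : |l| < ρ)
    {g : Lp ℝ 2 μ}
    (hg : Tendsto (fun k => ∫⁻ y, ‖moll k u (parallel ν l y) - g y‖ₑ ^ 2 ∂μ) atTop (𝓝 0))
    (g' : Lp ℝ 2 μ) : IsTraceAlong Γ μ (parallel ν l) u g' ↔ g' = g := by
  have ha : 0 < κ * |l| / 2 := by have := mul_pos h.ratio_pos h0; positivity
  obtain ⟨hu, hG⟩ := hE.tendsto_moll_shell hs ha hρ
  have hUo := isOpen_shell Γ (κ * |l| / 2) ρ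
  have hpU : ∀ y ∈ Γ, parallel ν l y ∈ shell Γ (κ * |l| / 2) ρ :=
    fun y hy => h.parallel_mem_shell h0 hl hy
  set U := shell Γ (κ * |l| / 2) ρ with hU
  have hsm : ∀ k, ContDiff ℝ ∞ (moll k u) := contDiff_moll hE.weak.locInt
  constructor
  · rintro ⟨U', hU', hpU', φ, hφ, hφu, hφG, hφg⟩
    rw [tendsto_eLpNorm_two_iff] at hφu hφG hφg
    obtain ⟨K, hK, hTI⟩ := h.exists_trace_inequality hl (hUo.inter hU')
      fun y hy => ⟨hpU y hy, hpU' y hy⟩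
    refine Lp_eq_of_tendsto (f := fun k y => φ k (parallel ν l y))
      (f' := fun k y => moll k u (parallel ν l y))
      (fun k => (h.memLp_comp_parallel l (hφ k).continuous).1)
      (fun k => (h.memLp_comp_parallel l (hsm k).continuous).1) hφg hg ?_
    have hlim := ENNReal.Tendsto.const_mul (a := K)
      ((tendsto_two_mul_add_two_mul hφu hu).add (tendsto_two_mul_add_two_mul hφG hG)) (Or.inr hK)
    rw [add_zero, mul_zero] at hlim
    refine tendsto_of_tendsto_of_tendsto_of_le_of_le tendsto_const_nhds hlim
      (fun _ => zero_le) fun k => ?_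
    refine (hTI (fun x => φ k x - moll k u x) ((hφ k).sub (hsm k))).trans ?_
    have hum : AEStronglyMeasurable u (volume.restrict (U ∩ U')) :=
      hE.weak.locInt.aestronglyMeasurable.restrict
    have hGm : AEStronglyMeasurable (weakGrad u) (volume.restrict (U ∩ U')) :=
      hE.weak.locInt_grad.aestronglyMeasurable.restrict
    have e1 := lintegral_enorm_sub_sq_le (m := volume.restrict (U ∩ U')) (f := φ k) (g := u)
      (h := moll k u) ((hsm k).continuous.aestronglyMeasurable.sub hum)
    have e2 := lintegral_enorm_sub_sq_le (m := volume.restrict (U ∩ U')) (f := gradient (φ k))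
      (g := weakGrad u) (h := gradient (moll k u))
      ((continuous_gradient (hsm k)).aestronglyMeasurable.sub hGm)
    simp only [gradient_sub_apply (hφ k) (hsm k)]
    simp only [gradient_moll hE.weak] at e2 ⊢
    gcongr
    · refine e1.trans ?_
      gcongr
      exacts [inter_subset_right, inter_subset_left]
    · refine e2.trans ?_
      gcongr
      exacts [inter_subset_right, inter_subset_left]
  · rintro rfl
    refine ⟨U, hUo, hpU, fun k => moll k u, hsm, ?_, ?_, ?_⟩
    · rwa [tendsto_eLpNorm_two_iff]
    · rw [tendsto_eLpNorm_two_iff]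
      simpa only [gradient_moll hE.weak] using hG
    · rwa [tendsto_eLpNorm_two_iff]

end IsNormalTube

/-- The integral of the weight `|r|^{-s}` over `(-t, t)`. -/
noncomputable def weightMass (s t : ℝ) : ℝ≥0∞ :=
  ∫⁻ r in Ioo (-t) t, ENNReal.ofReal (|r| ^ (-s))

theorem weightMass_ne_top {s : ℝ} (hs : s < 1) (t : ℝ) : weightMass s t ≠ ⊤ := by
  have h1 : IntervalIntegrable (fun r : ℝ => |r| ^ (-s)) volume 0 |t| := by
    refine (intervalIntegral.intervalIntegrable_rpow' (a := 0) (b := |t|)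
      (show -1 < -s by linarith)).congr fun r hr => ?_
    rw [uIoc_of_le (abs_nonneg t)] at hr
    simp only [abs_of_pos hr.1]
  have h2 : IntervalIntegrable (fun r : ℝ => |r| ^ (-s)) volume (-|t|) 0 := by
    have := (IntervalIntegrable.iff_comp_neg (f := fun r : ℝ => |r| ^ (-s))).1 h1.symm
    simpa using this
  have h3 := (intervalIntegrable_iff_integrableOn_Ioo_of_le
    (neg_le_self (abs_nonneg t))).1 (h2.trans h1)
  have h4 : Ioo (-t) t ⊆ Ioo (-|t|) |t| :=
    Ioo_subset_Ioo (neg_le_neg (le_abs_self t)) (le_abs_self t)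
  have h5 := (h3.mono_set h4).2
  rw [hasFiniteIntegral_iff_ofReal (Eventually.of_forall fun r => by positivity)] at h5
  exact h5.ne

theorem tendsto_weightMass {s : ℝ} (hs : s < 1) : Tendsto (weightMass s) (𝓝[>] 0) (𝓝 0) := by
  have h1 : Tendsto (fun t : ℝ => (volume.restrict (Ioo (-1 : ℝ) 1)) (Ioo (-t) t)) (𝓝[>] 0)
      (𝓝 0) := by
    have h0 : Tendsto (fun t : ℝ => ENNReal.ofReal (t - -t)) (𝓝 0) (𝓝 0) := by
      have : Continuous fun t : ℝ => ENNReal.ofReal (t - -t) :=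
        ENNReal.continuous_ofReal.comp (by fun_prop)
      simpa using this.tendsto 0
    refine tendsto_of_tendsto_of_tendsto_of_le_of_le tendsto_const_nhds
      (h0.mono_left nhdsWithin_le_nhds) (fun _ => zero_le) fun t => ?_
    rw [← Real.volume_Ioo]
    exact Measure.restrict_apply_le _ _
  refine (tendsto_setLIntegral_zero (weightMass_ne_top hs 1) h1).congr' ?_
  filter_upwards [Ioo_mem_nhdsGT one_pos] with t ht
  rw [Measure.restrict_restrict measurableSet_Ioo,
    inter_eq_left.2 (Ioo_subset_Ioo (neg_le_neg ht.2.le) ht.2.le), weightMass]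

theorem setLIntegral_sq_le_weightMass (s t : ℝ) {f : ℝ → ℝ≥0∞} (hf : Measurable f) :
    (∫⁻ r in Ioo (-t) t, f r) ^ 2 ≤
      weightMass s t * ∫⁻ r in Ioo (-t) t, ENNReal.ofReal (|r| ^ s) * f r ^ 2 := by
  have hm : ∀ p : ℝ, Measurable fun r : ℝ => ENNReal.ofReal (|r| ^ p) := fun p => by fun_prop
  have h1 := lintegral_mul_sq_le (m := volume.restrict (Ioo (-t) t))
    (f := fun r => ENNReal.ofReal (|r| ^ (-s / 2)))
    (g := fun r => ENNReal.ofReal (|r| ^ (s / 2)) * f r) (hm _).aemeasurable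
    ((hm _).mul hf).aemeasurable
  have hsq : ∀ p r : ℝ, ENNReal.ofReal (|r| ^ (p / 2)) ^ 2 = ENNReal.ofReal (|r| ^ p) := by
    intro p r
    rw [← ENNReal.ofReal_pow (by positivity), ← Real.rpow_natCast, ← Real.rpow_mul (abs_nonneg r)]
    norm_num
  simp only [mul_pow, hsq] at h1
  refine le_trans (pow_le_pow_left' (lintegral_mono_ae ?_) 2) h1
  filter_upwards [ae_restrict_of_ae (Measure.ae_ne volume (0 : ℝ))] with r hr
  rw [← mul_assoc, ← ENNReal.ofReal_mul (by positivity), ← Real.rpow_add (abs_pos.2 hr)]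
  simp [neg_div]

theorem ae_eq_of_tendsto_lintegral_sub_sq {X : Type*} [MeasurableSpace X] {m : Measure X}
    {f : ℕ → X → ℝ} {g h : X → ℝ} (hf : ∀ k, Measurable (f k)) (hg : Measurable g)
    (hfg : Tendsto (fun k => ∫⁻ x, ‖f k x - g x‖ₑ ^ 2 ∂m) atTop (𝓝 0))
    (hfh : ∀ᵐ x ∂m, Tendsto (fun k => f k x) atTop (𝓝 (h x))) : g =ᵐ[m] h := by
  have hm : ∀ k, Measurable fun x => ‖f k x - g x‖ₑ ^ 2 := fun k =>
    ((hf k).sub hg).enorm.pow_const 2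
  have h1 : ∫⁻ x, liminf (fun k => ‖f k x - g x‖ₑ ^ 2) atTop ∂m = 0 :=
    le_antisymm ((lintegral_liminf_le hm).trans hfg.liminf_eq.le) zero_le
  rw [lintegral_eq_zero_iff (Measurable.liminf hm)] at h1
  filter_upwards [h1, hfh] with x hx hh
  have h2 : Tendsto (fun k => ‖f k x - g x‖ₑ ^ 2) atTop (𝓝 (‖h x - g x‖ₑ ^ 2)) :=
    ((ENNReal.continuous_pow 2).tendsto _).comp
      ((continuous_enorm.tendsto _).comp (hh.sub_const (g x)))
  rw [h2.liminf_eq] at hx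
  have h3 : h x - g x = 0 := by simpa using hx
  linarith

namespace IsNormalTube

variable {n : ℕ} {Γ : Set (Space n)} {μ : Measure (Space n)} {ν : Space n → Space n} {ρ κ : ℝ}
  {C : ℝ≥0∞} {s δ : ℝ} {u : Space n → ℝ} {G : Space n → Space n} {E : ℝ≥0∞}

/-- The traces on two parallel sets, possibly on different sides of `Γ`, differ by at most the
integral of the gradient over the normal segment in between. -/
theorem ae_enorm_sub_le (h : IsNormalTube Γ μ ν ρ κ C) (hw : IsWeakGradient u G)
    {G' : Space n → Space n} (hG' : StronglyMeasurable G') (hGG' : G =ᵐ[volume] G') {t : ℝ}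
    (ht : t ≤ ρ) {l l' : ℝ} (hl : l ∈ Ioo (-t) t) (hl' : l' ∈ Ioo (-t) t) {g g' : Lp ℝ 2 μ}
    (hg : Tendsto (fun k => ∫⁻ y, ‖moll k u (parallel ν l y) - g y‖ₑ ^ 2 ∂μ) atTop (𝓝 0))
    (hg' : Tendsto (fun k => ∫⁻ y, ‖moll k u (parallel ν l' y) - g' y‖ₑ ^ 2 ∂μ) atTop (𝓝 0)) :
    ∀ᵐ y ∂μ, ‖g y - g' y‖ₑ ≤ ∫⁻ r in Ioo (-t) t, ‖G' (y + r • ν y)‖ₑ := by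
  have := h.finite
  have hsm : ∀ k, ContDiff ℝ ∞ (moll k u) := contDiff_moll hw.locInt
  have hgrad : ∀ k x, gradient (moll k u) x = moll k G' x := fun k x => by
    rw [gradient_moll hw, moll_congr_ae hGG']
  have hGc : ∀ k, Continuous (moll k G') := fun k => by
    rw [← funext (hgrad k)]; exact continuous_gradient (hsm k)
  have hDm : ∀ k, Measurable fun x => ‖moll k G' x - G' x‖ₑ := fun k =>
    ((hGc k).stronglyMeasurable.sub hG').enorm
  have hgm : ∀ k (l : ℝ) (g : Lp ℝ 2 μ), Measurable fun y => moll k u (parallel ν l y) - g y :=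
    fun k l g => ((hsm k).continuous.measurable.comp (h.measurable_parallel l)).sub
      (Lp.stronglyMeasurable g).measurable
  set S := {x | Metric.infDist x Γ < ρ} with hS
  have hSo : ∀ b, IsOpen {x | Metric.infDist x Γ < b} := fun b =>
    isOpen_lt (Metric.continuous_infDist_pt Γ) continuous_const
  have hlocal : Tendsto (fun k => ∫⁻ x in S, ‖moll k G' x - G' x‖ₑ ^ 1) atTop (𝓝 0) := by
    refine tendsto_setLIntegral_moll_sub (q := 1) le_rfl (hSo ρ).measurableSet
      (hSo (ρ + 1)).measurableSet one_pos (fun x hx y hy => ?_) ?_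
    · have h1 := Metric.infDist_le_infDist_add_dist (s := Γ) (x := y) (y := x)
      have h2 : Metric.infDist x Γ < ρ := hx
      exact (h1.trans_lt (add_lt_add h2 (Metric.mem_ball.1 hy)))
    · have h1 : {x | Metric.infDist x Γ < ρ + 1} = Metric.thickening (ρ + 1) Γ := by
        ext x
        rw [Metric.mem_thickening_iff_infDist_lt h.nonempty]
        rfl
      rw [Nat.cast_one, memLp_one_iff_integrable, h1]
      refine IntegrableOn.mono_set ?_ (Metric.thickening_subset_cthickening _ _)
      exact (hw.locInt_grad.integrableOn_isCompact h.compact.cthickening).congr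
        (ae_restrict_of_ae hGG')
  simp only [pow_one] at hlocal
  have hslice : ∀ k, ∫⁻ y, (∫⁻ r in Ioo (-t) t, ‖moll k G' (y + r • ν y) - G' (y + r • ν y)‖ₑ) ∂μ ≤
      C * ∫⁻ x in S, ‖moll k G' x - G' x‖ₑ := fun k =>
    h.lintegral_slice_le (hSo ρ).measurableSet measurableSet_Ioo
      (Ioo_subset_Ioo (neg_le_neg ht) ht)
      (fun y hy r hr => (h.infDist_le hy r).trans_lt ((abs_lt.2 hr).trans_le ht)) (hDm k)
  refine ae_le_of_tendsto_lintegral_zero (e := fun k y =>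
    ‖moll k u (parallel ν l y) - g y‖ₑ + ‖moll k u (parallel ν l' y) - g' y‖ₑ +
      ∫⁻ r in Ioo (-t) t, ‖moll k G' (y + r • ν y) - G' (y + r • ν y)‖ₑ) (fun k => ?_) (fun k => ?_)
      ?_
  · exact ((hgm k l g).enorm.add (hgm k l' g').enorm).add
      (h.measurable_setLIntegral (hDm k) _)
  · filter_upwards [h.ae_mem] with y hy
    have h1 := enorm_sub_le_lintegral_gradient (hsm k) (y := y) (h.norm_le y hy) hl hl'
    simp only [hgrad] at h1
    have h2 : ∫⁻ r in Ioo (-t) t, ‖moll k G' (y + r • ν y)‖ₑ ≤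
        (∫⁻ r in Ioo (-t) t, ‖G' (y + r • ν y)‖ₑ) +
          ∫⁻ r in Ioo (-t) t, ‖moll k G' (y + r • ν y) - G' (y + r • ν y)‖ₑ := by
      have hm : Measurable fun r : ℝ => ‖moll k G' (y + r • ν y) - G' (y + r • ν y)‖ₑ :=
        (hDm k).comp (by fun_prop : Measurable fun r : ℝ => y + r • ν y)
      rw [← lintegral_add_right _ hm]
      refine lintegral_mono fun r => ?_
      have := enorm_add_le (G' (y + r • ν y)) (moll k G' (y + r • ν y) - G' (y + r • ν y))
      rwa [add_sub_cancel] at this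
    have h3 : g y - g' y = -(moll k u (parallel ν l y) - g y) +
        (moll k u (parallel ν l' y) - g' y) +
          (moll k u (y + l • ν y) - moll k u (y + l' • ν y)) := by
      simp only [parallel]; ring
    rw [h3]
    refine (enorm_add_le _ _).trans ((add_le_add (enorm_add_le _ _) (h1.trans h2)).trans ?_)
    rw [enorm_neg]
    refine le_of_eq ?_
    ring
  · have a1 := tendsto_lintegral_enorm_of_sq (m := μ)
      (fun k => (hgm k l g).aestronglyMeasurable) hg
    have a2 := tendsto_lintegral_enorm_of_sq (m := μ)
      (fun k => (hgm k l' g').aestronglyMeasurable) hg'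
    have a3 : Tendsto (fun k => ∫⁻ y, (∫⁻ r in Ioo (-t) t,
        ‖moll k G' (y + r • ν y) - G' (y + r • ν y)‖ₑ) ∂μ) atTop (𝓝 0) := by
      refine tendsto_of_tendsto_of_tendsto_of_le_of_le tendsto_const_nhds ?_
        (fun _ => zero_le) hslice
      simpa using ENNReal.Tendsto.const_mul (a := C) hlocal (Or.inr h.const_ne_top)
    have a4 := (a1.add a2).add a3
    simp only [add_zero] at a4
    refine a4.congr fun k => ?_
    rw [lintegral_add_right _ (h.measurable_setLIntegral (hDm k) _),
      lintegral_add_right _ (hgm k l' g').enorm]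

/-- Mean square modulus of continuity of the traces in the distance to `Γ`. -/
theorem lintegral_sub_sq_le (h : IsNormalTube Γ μ ν ρ κ C) (hs : 0 ≤ s) (hρ : ρ < δ)
    (hE : HasEnergyNear Γ s δ u G E) {t : ℝ} (ht : t ≤ ρ) {l l' : ℝ} (hl : l ∈ Ioo (-t) t)
    (hl' : l' ∈ Ioo (-t) t) {g g' : Lp ℝ 2 μ}
    (hg : Tendsto (fun k => ∫⁻ y, ‖moll k u (parallel ν l y) - g y‖ₑ ^ 2 ∂μ) atTop (𝓝 0))
    (hg' : Tendsto (fun k => ∫⁻ y, ‖moll k u (parallel ν l' y) - g' y‖ₑ ^ 2 ∂μ) atTop (𝓝 0)) :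
    ∫⁻ y, ‖g y - g' y‖ₑ ^ 2 ∂μ ≤
      weightMass s t * ((ENNReal.ofReal (κ ^ s))⁻¹ * (C * E)) := by
  obtain ⟨G', hG', hGG'⟩ := hE.weak.locInt_grad.aestronglyMeasurable
  have hG'n : Measurable fun x => ‖G' x‖ₑ := hG'.enorm
  have hd : Measurable fun x => ENNReal.ofReal (Metric.infDist x Γ ^ s) :=
    ((Metric.continuous_infDist_pt Γ).measurable.pow_const s).ennreal_ofReal
  have hκ : ENNReal.ofReal (κ ^ s) ≠ 0 := by simpa using Real.rpow_pos_of_pos h.ratio_pos s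
  have hF : Measurable fun x => ENNReal.ofReal (Metric.infDist x Γ ^ s) * ‖G' x‖ₑ ^ 2 :=
    hd.mul (hG'n.pow_const 2)
  have hSo : IsOpen {x | Metric.infDist x Γ < ρ} :=
    isOpen_lt (Metric.continuous_infDist_pt Γ) continuous_const
  have hsl := h.lintegral_slice_le hSo.measurableSet measurableSet_Ioo
      (Ioo_subset_Ioo (neg_le_neg ht) ht)
      (fun y hy r hr => (h.infDist_le hy r).trans_lt ((abs_lt.2 hr).trans_le ht)) hF
  have hEF : ∫⁻ x in {x | Metric.infDist x Γ < ρ},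
      ENNReal.ofReal (Metric.infDist x Γ ^ s) * ‖G' x‖ₑ ^ 2 ≤ E := by
    refine le_trans (lintegral_mono_set fun x (hx : Metric.infDist x Γ < ρ) => hx.trans hρ)
      (le_trans (le_of_eq (lintegral_congr_ae ?_)) hE.grad_le)
    filter_upwards [ae_restrict_of_ae hGG'] with x hx using by rw [hx]
  calc ∫⁻ y, ‖g y - g' y‖ₑ ^ 2 ∂μ
      ≤ ∫⁻ y, weightMass s t * ((ENNReal.ofReal (κ ^ s))⁻¹ * ∫⁻ r in Ioo (-t) t,
        ENNReal.ofReal (Metric.infDist (y + r • ν y) Γ ^ s) * ‖G' (y + r • ν y)‖ₑ ^ 2) ∂μ := by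
        refine lintegral_mono_ae ?_
        filter_upwards [h.ae_enorm_sub_le hE.weak hG' hGG' ht hl hl' hg hg', h.ae_mem] with y hy hyΓ
        refine (pow_le_pow_left' hy 2).trans ((setLIntegral_sq_le_weightMass s t
          (hG'n.comp (by fun_prop : Measurable fun r : ℝ => y + r • ν y))).trans ?_)
        gcongr
        rw [← ENNReal.mul_le_iff_le_inv hκ ENNReal.ofReal_ne_top,
          ← lintegral_const_mul' _ _ ENNReal.ofReal_ne_top]
        refine setLIntegral_mono' measurableSet_Ioo fun r hr => ?_
        rw [← mul_assoc, ← ENNReal.ofReal_mul (by have := h.ratio_pos; positivity),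
          ← Real.mul_rpow h.ratio_pos.le (abs_nonneg r)]
        gcongr ENNReal.ofReal (?_ ^ s) * _
        · exact mul_nonneg h.ratio_pos.le (abs_nonneg r)
        · exact h.le_infDist y hyΓ r ((abs_lt.2 hr).trans_le ht)
    _ = weightMass s t * ((ENNReal.ofReal (κ ^ s))⁻¹ * ∫⁻ y, (∫⁻ r in Ioo (-t) t,
        ENNReal.ofReal (Metric.infDist (y + r • ν y) Γ ^ s) * ‖G' (y + r • ν y)‖ₑ ^ 2) ∂μ) := by
        rw [lintegral_const_mul _ ((h.measurable_setLIntegral hF _).const_mul _),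
          lintegral_const_mul _ (h.measurable_setLIntegral hF _)]
    _ ≤ _ := by
        gcongr
        exact hsl.trans (by gcongr)

end IsNormalTube

namespace IsNormalTube

variable {n : ℕ} {Γ : Set (Space n)} {μ : Measure (Space n)} {ν : Space n → Space n} {ρ κ : ℝ}
  {C : ℝ≥0∞} {s δ : ℝ}

/-- The trace operator, for a weighted space whose elements have finite energy near `Γ`. -/
theorem exists_trace_operator (h : IsNormalTube Γ μ ν ρ κ C) (hs : 0 ≤ s) (hs1 : s < 1)
    (hρ : ρ < δ) {α : Space n → ℝ} {E : weightedH1 α → ℝ≥0∞}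
    (hE : ∀ u : weightedH1 α, HasEnergyNear Γ s δ (u : Space n → ℝ) (weakGrad u) (E u)) :
    ∃ T : weightedH1 α →ₗ[ℝ] Lp ℝ 2 μ,
      (∃ K : ℝ≥0∞, K ≠ ⊤ ∧ ∀ u : weightedH1 α, ‖T u‖ₑ ^ 2 ≤ K * E u) ∧
      (∀ u : weightedH1 α, ContDiff ℝ ∞ (u : Space n → ℝ) →
        (T u : Space n → ℝ) =ᵐ[μ] (u : Space n → ℝ)) ∧
      ∃ R : ℝ → weightedH1 α → Lp ℝ 2 μ,
        (∀ l : ℝ, 0 < |l| → |l| < ρ → ∀ (u : weightedH1 α) (g : Lp ℝ 2 μ),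
          IsTraceAlong Γ μ (parallel ν l) (u : Space n → ℝ) g ↔ g = R l u) ∧
        ∀ u : weightedH1 α, Tendsto (fun l => R l u) (𝓝[≠] (0 : ℝ)) (𝓝 (T u)) := by
  have hρ0 := h.radius_pos
  have hex : ∀ (l : ℝ) (u : weightedH1 α), ∃ g : Lp ℝ 2 μ, 0 < |l| → |l| < ρ →
      Tendsto (fun k => ∫⁻ y, ‖moll k (u : Space n → ℝ) (parallel ν l y) - g y‖ₑ ^ 2 ∂μ)
        atTop (𝓝 0) := by
    intro l u
    by_cases hl : 0 < |l| ∧ |l| < ρ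
    · obtain ⟨g, hg⟩ := h.exists_tendsto_moll_parallel hs hρ (hE u) hl.1 hl.2
      exact ⟨g, fun _ _ => hg⟩
    · exact ⟨0, fun h1 h2 => absurd ⟨h1, h2⟩ hl⟩
  choose R hR using hex
  have hmollm : ∀ (u : weightedH1 α) (l : ℝ) (k : ℕ),
      Measurable fun y => moll k (u : Space n → ℝ) (parallel ν l y) := fun u l k =>
    (contDiff_moll (hE u).weak.locInt k).continuous.measurable.comp (h.measurable_parallel l)
  set c : ℝ≥0∞ := (ENNReal.ofReal (κ ^ s))⁻¹ * C with hc
  have hct : c ≠ ⊤ := ENNReal.mul_ne_top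
    (ENNReal.inv_ne_top.2 (by simpa using Real.rpow_pos_of_pos h.ratio_pos s)) h.const_ne_top
  have hmod : ∀ (u : weightedH1 α) (t : ℝ), t ≤ ρ → ∀ l l' : ℝ, 0 < |l| → |l| < t → 0 < |l'| →
      |l'| < t → edist (R l u) (R l' u) ^ 2 ≤ weightMass s t * (c * E u) := by
    intro u t ht l l' h0 hl h0' hl'
    rw [Lp_edist_sq, hc, mul_assoc]
    exact h.lintegral_sub_sq_le hs hρ (hE u) ht (abs_lt.1 hl) (abs_lt.1 hl')
      (hR l u h0 (hl.trans_le ht)) (hR l' u h0' (hl'.trans_le ht))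
  have hnear : ∀ t : ℝ, 0 < t → ∀ᶠ l : ℝ in 𝓝[≠] 0, 0 < |l| ∧ |l| < t := by
    intro t ht
    filter_upwards [self_mem_nhdsWithin, nhdsWithin_le_nhds (Metric.ball_mem_nhds (0 : ℝ) ht)]
      with l h1 h2
    exact ⟨abs_pos.2 h1, by simpa using h2⟩
  have hlim : ∀ u : weightedH1 α, ∃ g : Lp ℝ 2 μ, Tendsto (fun l => R l u) (𝓝[≠] (0 : ℝ)) (𝓝 g) := by
    intro u
    refine cauchy_map_iff_exists_tendsto.1 (EMetric.cauchy_iff.2 ⟨(inferInstance : NeBot _).ne, fun ε hε => ?_⟩)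
    have h1 := ENNReal.Tendsto.mul_const (b := c * E u) (tendsto_weightMass hs1)
      (Or.inr (ENNReal.mul_ne_top hct (hE u).ne_top))
    rw [zero_mul] at h1
    have h2 := (h1.eventually (gt_mem_nhds (pos_iff_ne_zero.2 (pow_ne_zero 2 hε.ne')))).and (Ioo_mem_nhdsGT hρ0)
    obtain ⟨t, ht, ht0, htρ⟩ := h2.exists
    refine ⟨_, image_mem_map (hnear t ht0), ?_⟩
    rintro _ ⟨l, hl, rfl⟩ _ ⟨l', hl', rfl⟩
    exact lt_of_pow_lt_pow_left' 2
      ((hmod u t htρ.le l l' hl.1 hl.2 hl'.1 hl'.2).trans_lt ht)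
  choose T hT using hlim
  have hRadd : ∀ (u v : weightedH1 α) (l : ℝ), 0 < |l| → |l| < ρ →
      R l (u + v) = R l u + R l v := by
    intro u v l h0 hl
    refine Lp_eq_of_tendsto (f := fun k y => moll k ((u + v : weightedH1 α) : Space n → ℝ)
        (parallel ν l y)) (f' := fun k y => moll k (u : Space n → ℝ) (parallel ν l y) +
        moll k (v : Space n → ℝ) (parallel ν l y)) (l := atTop)
      (fun k => (hmollm _ l k).aestronglyMeasurable)
      (fun k => ((hmollm u l k).add (hmollm v l k)).aestronglyMeasurable) (hR l _ h0 hl) ?_ ?_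
    · refine tendsto_of_tendsto_of_tendsto_of_le_of_le tendsto_const_nhds
        (tendsto_two_mul_add_two_mul (hR l u h0 hl) (hR l v h0 hl)) (fun _ => zero_le) fun k => ?_
      calc _ ≤ ∫⁻ y, (2 * ‖moll k (u : Space n → ℝ) (parallel ν l y) - R l u y‖ₑ ^ 2 +
            2 * ‖moll k (v : Space n → ℝ) (parallel ν l y) - R l v y‖ₑ ^ 2) ∂μ := by
            refine lintegral_mono_ae ?_
            filter_upwards [Lp.coeFn_add (R l u) (R l v)] with y hy
            rw [hy, Pi.add_apply, add_sub_add_comm]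
            exact enorm_add_sq_le _ _
        _ = _ := by
          have hm : Measurable fun y =>
              2 * ‖moll k (v : Space n → ℝ) (parallel ν l y) - R l v y‖ₑ ^ 2 :=
            (((hmollm v l k).sub
              (Lp.stronglyMeasurable (R l v)).measurable).enorm.pow_const 2).const_mul 2
          rw [lintegral_add_right _ hm,
            lintegral_const_mul' _ _ (by simp), lintegral_const_mul' _ _ (by simp)]
    · have e : ∀ k, moll k ((u + v : weightedH1 α) : Space n → ℝ) =
          moll k (u : Space n → ℝ) + moll k (v : Space n → ℝ) :=
        moll_add (hE u).weak.locInt (hE v).weak.locInt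
      simp only [e]
      simp
  have hRsmul : ∀ (a : ℝ) (u : weightedH1 α) (l : ℝ), 0 < |l| → |l| < ρ →
      R l (a • u) = a • R l u := by
    intro a u l h0 hl
    refine Lp_eq_of_tendsto (f := fun k y => moll k ((a • u : weightedH1 α) : Space n → ℝ)
        (parallel ν l y)) (f' := fun k y => a * moll k (u : Space n → ℝ) (parallel ν l y))
      (l := atTop)
      (fun k => (hmollm _ l k).aestronglyMeasurable)
      (fun k => ((hmollm u l k).const_mul a).aestronglyMeasurable) (hR l _ h0 hl) ?_ ?_
    · have h1 := ENNReal.Tendsto.const_mul (a := ‖a‖ₑ ^ 2) (hR l u h0 hl) (Or.inr (by simp))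
      rw [mul_zero] at h1
      refine h1.congr fun k => ?_
      rw [← lintegral_const_mul' _ _ (by simp)]
      refine lintegral_congr_ae ?_
      filter_upwards [Lp.coeFn_smul a (R l u)] with y hy
      rw [hy, Pi.smul_apply, smul_eq_mul, ← mul_sub, enorm_mul, mul_pow]
    · have e : ∀ k, moll k ((a • u : weightedH1 α) : Space n → ℝ) =
          a • moll k (u : Space n → ℝ) := moll_smul a _
      simp only [e]
      simp
  have hcoe : ∀ (u : weightedH1 α), ContDiff ℝ ∞ (u : Space n → ℝ) → ∀ l : ℝ, 0 < |l| →
      |l| < ρ → (R l u : Space n → ℝ) =ᵐ[μ] fun y => (u : Space n → ℝ) (parallel ν l y) :=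
    fun u hu l h0 hl => ae_eq_of_tendsto_lintegral_sub_sq (hmollm u l)
      (Lp.stronglyMeasurable _).measurable (hR l u h0 hl)
      (Eventually.of_forall fun y => tendsto_moll_of_continuous hu.continuous _)
  refine ⟨{ toFun := T, map_add' := fun u v => ?_, map_smul' := fun a u => ?_ }, ?_, ?_, R, ?_, hT⟩
  · refine tendsto_nhds_unique_of_eventuallyEq (hT (u + v)) ((hT u).add (hT v)) ?_
    filter_upwards [hnear ρ hρ0] with l hl using hRadd u v l hl.1 hl.2
  · refine tendsto_nhds_unique_of_eventuallyEq (hT (a • u)) ((hT u).const_smul a) ?_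
    filter_upwards [hnear ρ hρ0] with l hl using hRsmul a u l hl.1 hl.2
  · have hl0 : 0 < |ρ / 2| := abs_pos.2 (by positivity)
    have hl1 : |ρ / 2| < ρ := by rw [abs_of_pos (by positivity)]; linarith
    obtain ⟨K, hK, hKb⟩ := h.exists_trace_bound hs hρ hl0 hl1
    have hW := weightMass_ne_top hs1 ρ
    refine ⟨2 * (weightMass s ρ * c) + 2 * K, by finiteness, fun u => ?_⟩
    have h1 := hKb u _ (E u) _ (hE u) (hR _ u hl0 hl1)
    have h2 : edist (T u) (R (ρ / 2) u) ^ 2 ≤ weightMass s ρ * (c * E u) := by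
      have h3 : Tendsto (fun l => edist (R l u) (R (ρ / 2) u) ^ 2) (𝓝[≠] (0 : ℝ))
          (𝓝 (edist (T u) (R (ρ / 2) u) ^ 2)) :=
        ((ENNReal.continuous_pow 2).tendsto _).comp ((hT u).edist tendsto_const_nhds)
      refine le_of_tendsto h3 ?_
      filter_upwards [hnear ρ hρ0] with l hl using hmod u ρ le_rfl _ _ hl.1 hl.2 hl0 hl1
    have h4 : ‖R (ρ / 2) u‖ₑ ^ 2 ≤ K * E u := by
      have h3 := lintegral_enorm_pow_eq_eLpNorm_pow (m := μ) (R (ρ / 2) u) (q := 2) (by norm_num)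
      rw [h3] at h1
      rwa [Lp.enorm_def]
    have h5 := enorm_add_sq_le (T u - R (ρ / 2) u) (R (ρ / 2) u)
    rw [sub_add_cancel, ← edist_eq_enorm_sub] at h5
    refine h5.trans ((add_le_add (mul_le_mul_right h2 2) (mul_le_mul_right h4 2)).trans
      (le_of_eq ?_))
    ring
  · intro u hu
    have ht : ∀ k : ℕ, 0 < |ρ / (k + 2)| ∧ |ρ / (k + 2)| < ρ := fun k => by
      have h1 : 0 < ρ / (k + 2) := by positivity
      refine ⟨abs_pos.2 h1.ne', ?_⟩
      rw [abs_of_pos h1]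
      exact div_lt_self hρ0 (by have : (0 : ℝ) ≤ k := k.cast_nonneg; linarith)
    have hl0 : Tendsto (fun k : ℕ => ρ / ((k : ℝ) + 2)) atTop (𝓝 0) :=
      tendsto_const_nhds.div_atTop
        (tendsto_atTop_add_const_right _ _ tendsto_natCast_atTop_atTop)
    have hl : Tendsto (fun k : ℕ => ρ / ((k : ℝ) + 2)) atTop (𝓝[≠] 0) :=
      tendsto_nhdsWithin_iff.2 ⟨hl0, Eventually.of_forall fun k => abs_pos.1 (ht k).1⟩
    refine ae_eq_of_tendsto_lintegral_sub_sq
      (f := fun k y => (u : Space n → ℝ) (parallel ν (ρ / ((k : ℝ) + 2)) y))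
      (fun k => hu.continuous.measurable.comp (h.measurable_parallel _))
      (Lp.stronglyMeasurable _).measurable ?_ (Eventually.of_forall fun y => ?_)
    · have h1 := ((ENNReal.continuous_pow 2).tendsto 0).comp
        (tendsto_iff_edist_tendsto_0.1 ((hT u).comp hl))
      rw [zero_pow two_ne_zero] at h1
      refine h1.congr fun k => ?_
      rw [Function.comp_apply, Function.comp_apply, Lp_edist_sq]
      refine lintegral_congr_ae ?_
      filter_upwards [hcoe u hu _ (ht k).1 (ht k).2] with y hy
      rw [hy]
      rfl
    · have h1 : Continuous fun l : ℝ => (u : Space n → ℝ) (parallel ν l y) :=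
        hu.continuous.comp (by unfold parallel; fun_prop)
      have := (h1.tendsto 0).comp hl0
      simpa only [parallel, zero_smul, add_zero, Function.comp_def] using this
  · intro l h0 hl u g
    exact h.isTraceAlong_iff hs hρ (hE u) h0 hl (hR l u h0 hl) g

end IsNormalTube

/-- The vector of the period lattice with coordinates `2 k`. -/
noncomputable def latticeVec {n : ℕ} (k : Fin n → ℤ) : Space n :=
  WithLp.toLp 2 fun i => 2 * (k i : ℝ)

theorem IsPeriodic.add_latticeVec {n : ℕ} {F : Type*} {f : Space n → F} (hf : IsPeriodic f)
    (k : Fin n → ℤ) (x : Space n) : f (x + latticeVec k) = f x := by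
  have h1 : ∀ S : Finset (Fin n),
      Function.Periodic f (∑ i ∈ S, k i • EuclideanSpace.single i (2 : ℝ)) := by
    intro S
    induction S using Finset.induction_on with
    | empty => intro x; simp
    | insert i S hi ih =>
      rw [Finset.sum_insert hi]
      exact Function.Periodic.add_period
        (Function.Periodic.zsmul (fun x => hf x i) (k i)) ih
  have h2 : latticeVec k = ∑ i, k i • EuclideanSpace.single i (2 : ℝ) := by
    ext j
    simp [latticeVec, Finset.sum_apply, Pi.single_apply, mul_comm]
  rw [h2]
  exact h1 _ x

/-- The lattice shift carrying `x` into the box. -/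
noncomputable def boxShift {n : ℕ} (x : Space n) : Fin n → ℤ := fun i => -⌊(x i + 1) / 2⌋

theorem add_boxShift_mem {n : ℕ} (x : Space n) : x + latticeVec (boxShift x) ∈ box n := by
  intro i
  have h1 := Int.floor_le ((x i + 1) / 2)
  have h2 := Int.lt_floor_add_one ((x i + 1) / 2)
  simp only [latticeVec, boxShift, PiLp.add_apply, Int.cast_neg, mem_Ico]
  constructor <;> linarith

/-- Integrals of periodic functions over bounded sets are controlled by the integral over `B`. -/
theorem exists_setLIntegral_le_box {n : ℕ} {S : Set (Space n)} (hS : Bornology.IsBounded S) :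
    ∃ N : ℝ≥0∞, N ≠ ⊤ ∧ ∀ f : Space n → ℝ≥0∞, IsPeriodic f →
      ∫⁻ x in S, f x ≤ N * ∫⁻ x in box n, f x := by
  obtain ⟨M, hM⟩ := hS.exists_norm_le
  obtain ⟨m, hm⟩ := exists_nat_ge (M + 2)
  let K : Finset (Fin n → ℤ) := Fintype.piFinset fun _ => Finset.Icc (-(m : ℤ)) m
  refine ⟨K.card, by simp, fun f hf => ?_⟩
  have hcover : S ⊆ ⋃ k : K, (· + latticeVec (k : Fin n → ℤ)) ⁻¹' box n := by
    intro x hx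
    have hk : boxShift x ∈ K := by
      rw [Fintype.mem_piFinset]
      intro i
      have h1 := Int.floor_le ((x i + 1) / 2)
      have h2 := Int.lt_floor_add_one ((x i + 1) / 2)
      have h3 := abs_le.1 ((PiLp.norm_apply_le x i).trans (hM x hx))
      rw [Finset.mem_Icc]
      constructor
      · rw [boxShift, neg_le_neg_iff, ← Int.cast_le (R := ℝ), Int.cast_natCast]
        linarith [h3.1, h3.2]
      · rw [boxShift, neg_le, ← Int.cast_le (R := ℝ), Int.cast_neg, Int.cast_natCast]
        linarith [h3.1, h3.2]
    exact mem_iUnion.2 ⟨⟨_, hk⟩, add_boxShift_mem x⟩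
  calc ∫⁻ x in S, f x ≤ ∫⁻ x in ⋃ k : K, (· + latticeVec (k : Fin n → ℤ)) ⁻¹' box n, f x :=
        lintegral_mono_set hcover
    _ ≤ ∑' k : K, ∫⁻ x in (· + latticeVec (k : Fin n → ℤ)) ⁻¹' box n, f x :=
        lintegral_iUnion_le _ _
    _ = ∑' k : K, ∫⁻ x in box n, f x := by
        refine tsum_congr fun k => ?_
        rw [← (measurePreserving_add_right volume (latticeVec (k : Fin n → ℤ))).setLIntegral_comp_preimage_emb
          (measurableEmbedding_addRight _) f (box n)]
        simp only [hf.add_latticeVec]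
    _ = _ := by simp [tsum_fintype]

/-- The lower bound of a diffusivity by the distance holds in a full neighbourhood of `Γ`. -/
theorem IsDiffusivity.exists_le_near {n : ℕ} {Γ : Set (Space n)} {s : ℝ} {α : Space n → ℝ}
    (hα : IsDiffusivity Γ s α) (hΓ : IsCompact Γ) (hne : Γ.Nonempty) (hbox : Γ ⊆ box n) :
    ∃ δ : ℝ, 0 < δ ∧ ∃ c : ℝ, 1 ≤ c ∧ ∀ x, Metric.infDist x Γ < δ →
      c⁻¹ * Metric.infDist x Γ ^ s ≤ α x := by
  obtain ⟨c, hc, hcomp⟩ := hα.comparable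
  have hO : IsOpen {x : Space n | ∀ i, x i < 1} := by
    simp only [ofPred_forall]
    exact isOpen_iInter_of_finite fun i => isOpen_lt (by fun_prop) continuous_const
  obtain ⟨ε, hε, hsub⟩ := hΓ.exists_thickening_subset_open hO fun x hx i => (hbox hx i).2
  set δ := min (ε / 3) (1 / 2) with hδ
  have hδ0 : 0 < δ := lt_min (by positivity) (by norm_num)
  have hδ1 : δ ≤ 1 / 2 := min_le_right _ _
  have hδ2 : δ ≤ ε / 3 := min_le_left _ _
  refine ⟨δ, hδ0, c, hc, fun x hx => ?_⟩
  have hc0 : 0 ≤ c⁻¹ := by positivity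
  by_cases hxb : x ∈ box n
  · exact (hcomp x hxb).1
  set x' := x + latticeVec (boxShift x) with hx'
  have hfar : Metric.infDist x Γ ≤ Metric.infDist x' Γ := by
    by_contra! hlt
    obtain ⟨y, hy, hxy⟩ := (Metric.infDist_lt_iff hne).1 hx
    obtain ⟨y', hy', hxy'⟩ := (Metric.infDist_lt_iff hne).1 (hlt.trans hx)
    have hcoord : ∀ (a b : Space n) (i : Fin n), |a i - b i| ≤ dist a b := fun a b i => by
      rw [dist_eq_norm]
      exact PiLp.norm_apply_le (a - b) i
    have hx1 : ∀ i, x i < 1 := hsub (Metric.mem_thickening_iff.2 ⟨y, hy, by linarith⟩)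
    obtain ⟨i, hi⟩ : ∃ i, x i < -1 := by
      by_contra! hall
      exact hxb fun i => ⟨hall i, hx1 i⟩
    have h1 := abs_le.1 (hcoord x y i)
    have h2 := (hbox hy i).1
    have h3 := abs_le.1 (hcoord x' y' i)
    have hk : ⌊(x i + 1) / 2⌋ = -1 := by
      rw [Int.floor_eq_iff]
      constructor <;> push_cast <;> linarith
    have h4 : x' i = x i + 2 := by
      simp [hx', latticeVec, boxShift, hk]
    have h5 : y' + EuclideanSpace.single i (2 * δ) ∈ Metric.thickening ε Γ := by
      refine Metric.mem_thickening_iff.2 ⟨y', hy', ?_⟩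
      rw [dist_eq_norm, add_sub_cancel_left, PiLp.norm_single, Real.norm_eq_abs,
        abs_of_pos (by positivity)]
      linarith
    have h6 := hsub h5 i
    simp only [PiLp.add_apply, PiLp.single_apply, if_true] at h6
    linarith
  calc c⁻¹ * Metric.infDist x Γ ^ s ≤ c⁻¹ * Metric.infDist x' Γ ^ s := by
        gcongr
        · exact Metric.infDist_nonneg
        · exact hα.exponent.1
    _ ≤ α x' := (hcomp x' (add_boxShift_mem x)).1
    _ = α x := hα.periodic.add_latticeVec _ x

theorem IsDiffusivity.nonneg {n : ℕ} {Γ : Set (Space n)} {s : ℝ} {α : Space n → ℝ}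
    (hα : IsDiffusivity Γ s α) (x : Space n) : 0 ≤ α x := by
  obtain ⟨c, hc, hcomp⟩ := hα.comparable
  rw [← hα.periodic.add_latticeVec (boxShift x) x]
  refine le_trans ?_ (hcomp _ (add_boxShift_mem x)).1
  have := Metric.infDist_nonneg (s := Γ) (x := x + latticeVec (boxShift x))
  positivity

theorem enorm_sq_eq_ofReal {F : Type*} [SeminormedAddCommGroup F] (v : F) :
    ‖v‖ₑ ^ 2 = ENNReal.ofReal (‖v‖ ^ 2) := by
  rw [ENNReal.ofReal_pow (norm_nonneg v), ofReal_norm]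

/-- The square of the weighted norm as a lower integral. -/
theorem ofReal_weightedH1Norm_sq {n : ℕ} {α : Space n → ℝ} (hα : ∀ x, 0 ≤ α x)
    (u : weightedH1 α) :
    ENNReal.ofReal (weightedH1Norm α (u : Space n → ℝ) ^ 2) =
      (∫⁻ x in box n, ‖(u : Space n → ℝ) x‖ₑ ^ 2) +
        ∫⁻ x in box n, ‖√(α x) • weakGrad (u : Space n → ℝ) x‖ₑ ^ 2 := by
  obtain ⟨u, hper, hu2, G, hGper, hw, hG2⟩ := u
  have hae := hw.ae_eq (isWeakGradient_weakGrad hw)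
  have hG2' : MemLp (fun x => √(α x) • weakGrad u x) 2 (volume.restrict (box n)) := by
    refine hG2.ae_eq ?_
    filter_upwards [ae_restrict_of_ae hae] with x hx using by rw [hx]
  have e : ∀ x, α x * ‖weakGrad u x‖ ^ 2 = ‖√(α x) • weakGrad u x‖ ^ 2 := fun x => by
    rw [norm_smul, mul_pow, Real.norm_eq_abs, sq_abs, Real.sq_sqrt (hα x)]
  have e2 : ∀ x, u x ^ 2 = ‖u x‖ ^ 2 := fun x => by rw [Real.norm_eq_abs, sq_abs]
  have i1 := hu2.integrable_norm_pow two_ne_zero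
  have i2 := hG2'.integrable_norm_pow two_ne_zero
  simp only [weightedH1Norm, e, e2]
  rw [Real.sq_sqrt (by positivity), ENNReal.ofReal_add (by positivity) (by positivity),
    ofReal_integral_eq_lintegral_ofReal i1 (Eventually.of_forall fun x => by positivity),
    ofReal_integral_eq_lintegral_ofReal i2 (Eventually.of_forall fun x => by positivity)]
  simp only [enorm_sq_eq_ofReal]

/-- Elements of the weighted space have finite energy near `Γ`, controlled by their norm. -/
theorem IsDiffusivity.exists_hasEnergyNear {n : ℕ} {Γ : Set (Space n)} {s : ℝ} {α : Space n → ℝ}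
    (hα : IsDiffusivity Γ s α) (hΓ : IsCompact Γ) (hne : Γ.Nonempty) (hbox : Γ ⊆ box n) :
    ∃ δ : ℝ, 0 < δ ∧ ∃ N : ℝ≥0∞, N ≠ ⊤ ∧ ∀ u : weightedH1 α,
      HasEnergyNear Γ s δ (u : Space n → ℝ) (weakGrad u)
        (N * ENNReal.ofReal (weightedH1Norm α (u : Space n → ℝ) ^ 2)) := by
  obtain ⟨δ, hδ, c, hc, hle⟩ := hα.exists_le_near hΓ hne hbox
  have hbdd : Bornology.IsBounded {x | Metric.infDist x Γ < δ} := by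
    have h1 : {x | Metric.infDist x Γ < δ} = Metric.thickening δ Γ := by
      ext x
      rw [Metric.mem_thickening_iff_infDist_lt hne]
      rfl
    rw [h1]
    exact hΓ.isBounded.thickening
  obtain ⟨N, hN, hNle⟩ := exists_setLIntegral_le_box hbdd
  refine ⟨δ, hδ, ENNReal.ofReal c * N, by finiteness, fun u => ?_⟩
  rw [ofReal_weightedH1Norm_sq hα.nonneg]
  have hfin : (∫⁻ x in box n, ‖(u : Space n → ℝ) x‖ₑ ^ 2) +
      ∫⁻ x in box n, ‖√(α x) • weakGrad (u : Space n → ℝ) x‖ₑ ^ 2 ≠ ⊤ := by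
    rw [← ofReal_weightedH1Norm_sq hα.nonneg]
    exact ENNReal.ofReal_ne_top
  obtain ⟨u, hper, hu2, G, hGper, hw, hG2⟩ := u
  have hae := hw.ae_eq (isWeakGradient_weakGrad hw)
  have hc1 : 1 ≤ ENNReal.ofReal c := by simpa using hc
  refine ⟨isWeakGradient_weakGrad hw, ENNReal.mul_ne_top (by finiteness) hfin, ?_, ?_⟩
  · refine (hNle (fun x => ‖u x‖ₑ ^ 2) fun x i => by simp only [hper x i]).trans ?_
    calc _ ≤ 1 * N * ((∫⁻ x in box n, ‖u x‖ₑ ^ 2) +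
          ∫⁻ x in box n, ‖√(α x) • weakGrad u x‖ₑ ^ 2) := by
          rw [one_mul]
          gcongr
          exact le_self_add
      _ ≤ _ := by gcongr
  · have hS : MeasurableSet {x | Metric.infDist x Γ < δ} :=
      (isOpen_lt (Metric.continuous_infDist_pt Γ) continuous_const).measurableSet
    calc ∫⁻ x in {x | Metric.infDist x Γ < δ},
          ENNReal.ofReal (Metric.infDist x Γ ^ s) * ‖weakGrad u x‖ₑ ^ 2
        ≤ ∫⁻ x in {x | Metric.infDist x Γ < δ}, ENNReal.ofReal c * ‖√(α x) • G x‖ₑ ^ 2 := by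
          refine lintegral_mono_ae ?_
          filter_upwards [ae_restrict_mem hS, ae_restrict_of_ae hae] with x hx hGx
          rw [← hGx, enorm_smul, mul_pow, enorm_sq_eq_ofReal √(α x), Real.norm_eq_abs, sq_abs,
            Real.sq_sqrt (hα.nonneg x), ← mul_assoc, ← ENNReal.ofReal_mul (by linarith)]
          gcongr
          have h1 := hle x hx
          rwa [inv_mul_le_iff₀ (by linarith)] at h1
      _ = ENNReal.ofReal c * ∫⁻ x in {x | Metric.infDist x Γ < δ}, ‖√(α x) • G x‖ₑ ^ 2 :=
          lintegral_const_mul' _ _ ENNReal.ofReal_ne_top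
      _ ≤ ENNReal.ofReal c * (N * ∫⁻ x in box n, ‖√(α x) • G x‖ₑ ^ 2) := by
          gcongr
          exact hNle _ fun x i => by simp only [hGper x i, hα.periodic x i]
      _ = ENNReal.ofReal c * (N * ∫⁻ x in box n, ‖√(α x) • weakGrad u x‖ₑ ^ 2) := by
          congr 2
          refine lintegral_congr_ae ?_
          filter_upwards [ae_restrict_of_ae hae] with x hx using by rw [hx]
      _ ≤ _ := by
          rw [← mul_assoc]
          gcongr
          exact le_add_self

theorem measurable_indicator_of_continuousOn {n : ℕ} {Γ : Set (Space n)} {ν : Space n → Space n}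
    (hΓ : IsClosed Γ) (hν : ContinuousOn ν Γ) : Measurable (Γ.indicator ν) := by
  classical
  rw [← piecewise_eq_indicator]
  exact hν.measurable_piecewise continuousOn_const hΓ.measurableSet

/-- The one-dimensional degeneration set has a normal tube. -/
theorem IsPointPair.exists_isNormalTube {n : ℕ} {Γ : Set (Space n)} {μ : Measure (Space n)}
    {ν : Space n → Space n} (h : IsPointPair Γ μ ν) :
    ∃ ρ κ : ℝ, ∃ C : ℝ≥0∞, IsNormalTube Γ μ (Γ.indicator ν) ρ κ C := by
  obtain ⟨rfl, hΓ, hμ, hr, hl⟩ := h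
  set e : ℝ → Space 1 := fun r => WithLp.toLp 2 fun _ => r with he
  have hΓ' : Γ = {e (1 / 2), e (-(1 / 2))} := hΓ
  have hμ' : μ = Measure.dirac (e (1 / 2)) + Measure.dirac (e (-(1 / 2))) := hμ
  have hfin : Γ.Finite := by rw [hΓ']; simp
  have hdist : ∀ r r' : ℝ, dist (e r) (e r') = |r - r'| := fun r r' => by
    simp [EuclideanSpace.dist_eq, he, Real.sqrt_sq_eq_abs, Real.dist_eq]
  have ma : e (1 / 2) ∈ Γ := by rw [hΓ']; simp
  have mb : e (-(1 / 2)) ∈ Γ := by rw [hΓ']; simp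
  have hνa : Γ.indicator ν (e (1 / 2)) = e 1 := by rw [indicator_of_mem ma]; exact hr
  have hνb : Γ.indicator ν (e (-(1 / 2))) = e (-1) := by rw [indicator_of_mem mb]; exact hl
  have hcases : ∀ y ∈ Γ, ∃ d : ℝ, |d| = 1 ∧ y = e (d / 2) ∧ Γ.indicator ν y = e d := by
    intro y hy
    rw [hΓ'] at hy
    rcases hy with rfl | rfl
    · exact ⟨1, by simp, rfl, hνa⟩
    · exact ⟨-1, by simp, by congr 1; ring, hνb⟩
  have hadd : ∀ a r d : ℝ, e a + r • e d = e (a + r * d) := fun a r d => by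
    ext i; simp [he]
  have hvol : MeasurePreserving e volume volume := by
    have h1 := (PiLp.volume_preserving_ofLp (Fin 1)).symm (MeasurableEquiv.toLp 2 (Fin 1 → ℝ)).symm
    have h2 := (volume_preserving_funUnique (Fin 1) ℝ).symm
    exact h1.comp h2
  refine ⟨1 / 4, 1, 2, ⟨hfin.isCompact, ⟨_, ma⟩, ?_, ?_,
    measurable_indicator_of_continuousOn hfin.isClosed (hfin.continuousOn ν), hfin.continuousOn _,
    ?_, by norm_num, one_pos, ?_, by simp, ?_⟩⟩
  · rw [hμ']; infer_instance
  · rw [hμ', ae_add_measure_iff, ae_dirac_eq, ae_dirac_eq]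
    exact ⟨ma, mb⟩
  · intro y hy
    obtain ⟨d, hd, -, hν⟩ := hcases y hy
    rw [hν]
    have := hdist d 0
    rw [dist_eq_norm, show e 0 = 0 from by ext i; simp [he]] at this
    simpa [hd] using this.le
  · intro y hy r hr
    obtain ⟨d, hd, hyd, hν⟩ := hcases y hy
    rw [Metric.le_infDist ⟨_, ma⟩, hν, hyd, hadd, one_mul]
    intro z hz
    obtain ⟨d', hd', rfl, -⟩ := hcases z hz
    rw [hdist]
    have hr' := abs_lt.1 hr
    rcases (abs_eq one_pos.le).1 hd with rfl | rfl <;>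
      rcases (abs_eq one_pos.le).1 hd' with rfl | rfl
    · rw [show 1 / 2 + r * 1 - 1 / 2 = r by ring]
    · rw [show 1 / 2 + r * 1 - -1 / 2 = 1 + r by ring]
      exact hr.le.trans ((by linarith [hr'.1] : 1 / 4 ≤ 1 + r).trans (le_abs_self _))
    · rw [show -1 / 2 + r * -1 - 1 / 2 = -(1 + r) by ring, abs_neg]
      exact hr.le.trans ((by linarith [hr'.1] : 1 / 4 ≤ 1 + r).trans (le_abs_self _))
    · rw [show -1 / 2 + r * -1 - -1 / 2 = -r by ring, abs_neg]
  · intro F hF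
    have hFe : Measurable fun x : ℝ => F (e x) := hF.comp hvol.measurable
    have hint : ∫⁻ x : ℝ, F (e x) = ∫⁻ x, F x := hvol.lintegral_comp hF
    rw [hμ', lintegral_add_measure, lintegral_dirac, lintegral_dirac, hνa, hνb, two_mul]
    simp only [hadd]
    refine add_le_add ((setLIntegral_le_lintegral _ _).trans (le_of_eq ?_))
      ((setLIntegral_le_lintegral _ _).trans (le_of_eq ?_))
    · rw [← hint]
      simpa using lintegral_add_left_eq_self (μ := volume) (fun x => F (e x)) (1 / 2)
    · rw [← hint]
      simpa [sub_eq_add_neg] using lintegral_sub_left_eq_self (μ := volume) (fun x => F (e x)) (-(1 / 2))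

/-- The rotation of the plane by a right angle. -/
noncomputable def quarterTurn : Space 2 →L[ℝ] Space 2 :=
  LinearMap.toContinuousLinearMap
    { toFun := fun v => !₂[-v 1, v 0]
      map_add' := fun v w => by ext i; fin_cases i <;> simp [add_comm]
      map_smul' := fun c v => by ext i; fin_cases i <;> simp }

theorem quarterTurn_zero (v : Space 2) : quarterTurn v 0 = -v 1 := rfl

theorem quarterTurn_one (v : Space 2) : quarterTurn v 1 = v 0 := rfl

theorem inner_plane (v w : Space 2) : inner ℝ v w = v 0 * w 0 + v 1 * w 1 := by
  simp [PiLp.inner_apply, Fin.sum_univ_two, mul_comm]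

theorem norm_sq_plane (v : Space 2) : ‖v‖ ^ 2 = v 0 ^ 2 + v 1 ^ 2 := by
  simp [EuclideanSpace.real_norm_sq_eq, Fin.sum_univ_two]

theorem norm_quarterTurn (v : Space 2) : ‖quarterTurn v‖ = ‖v‖ := by
  rw [← sq_eq_sq₀ (norm_nonneg _) (norm_nonneg _), norm_sq_plane, norm_sq_plane, quarterTurn_zero,
    quarterTurn_one]
  ring

/-- A curve `γ` of unit speed with tangent `τ`, normal `N` and curvature at most `M`. -/
structure IsFramedCurve (γ τ N N' : ℝ → Space 2) (M : ℝ) : Prop where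
  one_le : 1 ≤ M
  hasDerivAt : ∀ t, HasDerivAt γ (τ t) t
  hasDerivAt_normal : ∀ t, HasDerivAt N (N' t) t
  norm_tangent : ∀ t, ‖τ t‖ = 1
  norm_normal : ∀ t, ‖N t‖ = 1
  inner_eq_zero : ∀ t, inner ℝ (N t) (τ t) = 0
  lipschitz_tangent : ∀ t t', ‖τ t' - τ t‖ ≤ M * |t' - t|
  lipschitz_normal : ∀ t t', ‖N t' - N t‖ ≤ M * |t' - t|
  norm_deriv_normal_le : ∀ t, ‖N' t‖ ≤ M
  abs_det : ∀ t (A : Space 2), |A 0 * N t 1 - A 1 * N t 0| = |inner ℝ A (τ t)|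

theorem IsSmoothClosedCurve.exists_isFramedCurve {Γ : Set (Space 2)} {μ : Measure (Space 2)}
    {ν : Space 2 → Space 2} {L : ℝ} {γ : ℝ → Space 2} (h : IsSmoothClosedCurve Γ μ ν L γ) :
    ∃ N' : ℝ → Space 2, ∃ M : ℝ, IsFramedCurve γ (deriv γ) (fun t => ν (γ t)) N' M := by
  set τ := deriv γ with hτ
  have hτs : ContDiff ℝ ∞ τ := (contDiff_infty_iff_deriv.1 h.smooth).2
  have hτ's : ContDiff ℝ ∞ (deriv τ) := (contDiff_infty_iff_deriv.1 hτs).2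
  have hd : ∀ t, HasDerivAt γ (τ t) t := fun t =>
    ((h.smooth.differentiable (by simp)) t).hasDerivAt
  have hd2 : ∀ t, HasDerivAt τ (deriv τ t) t := fun t =>
    ((hτs.differentiable (by simp)) t).hasDerivAt
  have hper : ∀ {f : ℝ → Space 2}, Function.Periodic f L → Function.Periodic (deriv f) L := by
    intro f hf t
    rw [← deriv_comp_add_const]
    congr 1
    exact funext hf
  obtain ⟨M₀, hM₀⟩ := ((hper (hper h.closed)).isBounded_of_continuous h.length_pos.ne'
    hτ's.continuous).exists_norm_le
  set M := max M₀ 1 with hM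
  have hMb : ∀ t, ‖deriv τ t‖ ≤ M := fun t => (hM₀ _ (mem_range_self t)).trans (le_max_left _ _)
  have hlip : ∀ t t', ‖τ t' - τ t‖ ≤ M * |t' - t| := fun t t' =>
    convex_univ.norm_image_sub_le_of_norm_hasDerivWithin_le
      (fun x _ => (hd2 x).hasDerivWithinAt) (fun x _ => hMb x) (mem_univ t) (mem_univ t')
  have hτ1 : ∀ t, τ t 0 ^ 2 + τ t 1 ^ 2 = 1 := fun t => by
    rw [← norm_sq_plane, h.unit_speed t, one_pow]
  have hN1 : ∀ t, ν (γ t) 0 ^ 2 + ν (γ t) 1 ^ 2 = 1 := fun t => by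
    rw [← norm_sq_plane, h.normal_unit t, one_pow]
  have horth : ∀ t, ν (γ t) 0 * τ t 0 + ν (γ t) 1 * τ t 1 = 0 := fun t => by
    rw [← inner_plane]; exact h.normal_orth t
  have hNc : Continuous fun t => ν (γ t) := h.normal_cont.comp_continuous h.smooth.continuous
    fun t => by rw [h.set_eq]; exact mem_range_self t
  have hcoord : ∀ i : Fin 2, Continuous fun v : Space 2 => v i := fun i => by fun_prop
  obtain ⟨c, hc2, hc⟩ : ∃ c : ℝ, c ^ 2 = 1 ∧
      ∀ t, ν (γ t) 1 * τ t 0 - ν (γ t) 0 * τ t 1 = c := by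
    have hcont : Continuous fun t => ν (γ t) 1 * τ t 0 - ν (γ t) 0 * τ t 1 :=
      (((hcoord 1).comp hNc).mul ((hcoord 0).comp hτs.continuous)).sub
        (((hcoord 0).comp hNc).mul ((hcoord 1).comp hτs.continuous))
    have hsq : EqOn ((fun t => ν (γ t) 1 * τ t 0 - ν (γ t) 0 * τ t 1) ^ 2)
        ((fun _ => (1 : ℝ)) ^ 2) univ := by
      intro t _
      simp only [Pi.pow_apply]
      linear_combination (ν (γ t) 0 ^ 2 + ν (γ t) 1 ^ 2) * hτ1 t + hN1 t -
        (ν (γ t) 0 * τ t 0 + ν (γ t) 1 * τ t 1) * horth t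
    rcases isPreconnected_univ.eq_or_eq_neg_of_sq_eq hcont.continuousOn continuousOn_const hsq
      (fun _ => one_ne_zero) with h1 | h1
    · exact ⟨1, by norm_num, fun t => h1 (mem_univ t)⟩
    · exact ⟨-1, by norm_num, fun t => h1 (mem_univ t)⟩
  have hN : ∀ t, ν (γ t) = c • quarterTurn (τ t) := by
    intro t
    ext i
    fin_cases i
    · simp only [Fin.zero_eta, PiLp.smul_apply, quarterTurn_zero, smul_eq_mul, ← hc t]
      linear_combination (-ν (γ t) 0) * hτ1 t + τ t 0 * horth t
    · simp only [Fin.mk_one, PiLp.smul_apply, quarterTurn_one, smul_eq_mul, ← hc t]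
      linear_combination (-ν (γ t) 1) * hτ1 t + τ t 1 * horth t
  have hcabs : |c| = 1 := by
    rw [← sq_eq_sq₀ (abs_nonneg c) one_pos.le, sq_abs, hc2, one_pow]
  have hnorm : ∀ v, ‖c • quarterTurn v‖ = ‖v‖ := fun v => by
    rw [norm_smul, Real.norm_eq_abs, hcabs, one_mul, norm_quarterTurn]
  refine ⟨fun t => c • quarterTurn (deriv τ t), M, le_max_right _ _, hd, fun t => ?_, h.unit_speed,
    h.normal_unit, h.normal_orth, hlip, fun t t' => ?_, fun t => ?_, fun t A => ?_⟩
  · rw [funext hN]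
    exact (quarterTurn.hasFDerivAt.comp_hasDerivAt t (hd2 t)).const_smul c
  · simp only [hN]
    rw [← smul_sub, ← map_sub, hnorm]
    exact hlip t t'
  · rw [hnorm]
    exact hMb t
  · rw [hN, inner_plane]
    simp only [PiLp.smul_apply, quarterTurn_zero, quarterTurn_one, smul_eq_mul]
    rw [show A 0 * (c * τ t 0) - A 1 * (c * -τ t 1) = c * (A 0 * τ t 0 + A 1 * τ t 1) by ring,
      abs_mul, hcabs, one_mul]

/-- The linear map of the plane with columns `a` and `b`. -/
noncomputable def columnMap (a b : Space 2) : Space 2 →L[ℝ] Space 2 :=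
  (EuclideanSpace.proj (0 : Fin 2) : Space 2 →L[ℝ] ℝ).smulRight a +
    (EuclideanSpace.proj (1 : Fin 2) : Space 2 →L[ℝ] ℝ).smulRight b

theorem det_columnMap (a b : Space 2) : (columnMap a b).det = a 0 * b 1 - a 1 * b 0 := by
  rw [ContinuousLinearMap.det,
    ← LinearMap.det_toMatrix (EuclideanSpace.basisFun (Fin 2) ℝ).toBasis, Matrix.det_fin_two]
  simp [LinearMap.toMatrix_apply, columnMap]
  ring

namespace IsFramedCurve

variable {γ τ N N' : ℝ → Space 2} {M : ℝ}

theorem norm_sub_sub_le (h : IsFramedCurve γ τ N N' M) (t t' : ℝ) :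
    ‖γ t' - γ t - (t' - t) • τ t‖ ≤ M * |t' - t| ^ 2 := by
  have hM := h.one_le
  have hd : ∀ x, HasDerivAt (fun x => γ x - x • τ t) (τ x - τ t) x := fun x => by
    have h1 : HasDerivAt (fun x : ℝ => x • τ t) (τ t) x := by
      simpa using (hasDerivAt_id x).smul_const (τ t)
    exact (h.hasDerivAt x).sub h1
  have hb : ∀ x ∈ uIcc t t', ‖τ x - τ t‖ ≤ M * |t' - t| := fun x hx =>
    (h.lipschitz_tangent t x).trans
      (mul_le_mul_of_nonneg_left (abs_sub_left_of_mem_uIcc hx) (by linarith))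
  have := (convex_uIcc t t').norm_image_sub_le_of_norm_hasDerivWithin_le
    (fun x _ => (hd x).hasDerivWithinAt) hb left_mem_uIcc right_mem_uIcc
  rw [Real.norm_eq_abs, mul_assoc, ← sq] at this
  have h2 : γ t' - γ t - (t' - t) • τ t = γ t' - t' • τ t - (γ t - t • τ t) := by
    rw [sub_smul]; abel
  rwa [h2]

theorem inner_tangent_self (h : IsFramedCurve γ τ N N' M) (t : ℝ) : inner ℝ (τ t) (τ t) = 1 := by
  rw [real_inner_self_eq_norm_sq, h.norm_tangent, one_pow]

theorem inner_normal_self (h : IsFramedCurve γ τ N N' M) (t : ℝ) : inner ℝ (N t) (N t) = 1 := by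
  rw [real_inner_self_eq_norm_sq, h.norm_normal, one_pow]

theorem abs_inner_le {v w : Space 2} (hw : ‖w‖ = 1) : |inner ℝ v w| ≤ ‖v‖ := by
  have := abs_real_inner_le_norm v w
  rwa [hw, mul_one] at this

/-- Normal displacement keeps a distance from nearby points of the curve. -/
theorem half_abs_le_dist (h : IsFramedCurve γ τ N N' M) {t t' : ℝ} (r : ℝ)
    (ht : M * |t' - t| ≤ 1 / 2) : 1 / 2 * |r| ≤ dist (γ t + r • N t) (γ t') := by
  set e := γ t' - γ t - (t' - t) • τ t with he
  have heb : ‖e‖ ≤ M * |t' - t| ^ 2 := h.norm_sub_sub_le t t'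
  have hv : γ t + r • N t - γ t' = r • N t - (t' - t) • τ t - e := by rw [he]; abel
  have h0 := abs_nonneg (t' - t)
  have hτN : inner ℝ (τ t) (N t) = 0 := by rw [real_inner_comm]; exact h.inner_eq_zero t
  rw [dist_eq_norm, hv]
  by_cases hr : |r| ≤ |t' - t|
  · have h1 := abs_inner_le (v := r • N t - (t' - t) • τ t - e) (h.norm_tangent t)
    have h2 := abs_inner_le (v := e) (h.norm_tangent t)
    rw [inner_sub_left, inner_sub_left, real_inner_smul_left, real_inner_smul_left,
      h.inner_eq_zero, h.inner_tangent_self] at h1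
    have h3 := abs_sub_abs_le_abs_sub (t' - t) (-inner ℝ e (τ t))
    rw [abs_neg] at h3
    have h4 : |r * 0 - (t' - t) * 1 - inner ℝ e (τ t)| = |t' - t - -inner ℝ e (τ t)| := by
      rw [← abs_neg]; congr 1; ring
    nlinarith
  · have h1 := abs_inner_le (v := r • N t - (t' - t) • τ t - e) (h.norm_normal t)
    have h2 := abs_inner_le (v := e) (h.norm_normal t)
    rw [inner_sub_left, inner_sub_left, real_inner_smul_left, real_inner_smul_left,
      h.inner_normal_self, hτN] at h1
    have h3 := abs_sub_abs_le_abs_sub r (inner ℝ e (N t))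
    have h4 : r * 1 - (t' - t) * 0 - inner ℝ e (N t) = r - inner ℝ e (N t) := by ring
    rw [h4] at h1
    push Not at hr
    nlinarith

/-- The normal coordinates `(t, r) ↦ γ t + r N t`. -/
def tubeMap (γ N : ℝ → Space 2) (x : Space 2) : Space 2 := γ (x 0) + x 1 • N (x 0)

theorem hasFDerivAt_tubeMap (h : IsFramedCurve γ τ N N' M) (x : Space 2) :
    HasFDerivAt (tubeMap γ N)
      (columnMap (τ (x 0) + x 1 • N' (x 0)) (N (x 0))) x := by
  have p0 := (EuclideanSpace.proj (0 : Fin 2) : Space 2 →L[ℝ] ℝ).hasFDerivAt (x := x)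
  have p1 := (EuclideanSpace.proj (1 : Fin 2) : Space 2 →L[ℝ] ℝ).hasFDerivAt (x := x)
  have h1 := (h.hasDerivAt (x 0)).hasFDerivAt.comp x p0
  have h2 := (h.hasDerivAt_normal (x 0)).hasFDerivAt.comp x p0
  refine (h1.add (p1.smul h2)).congr_fderiv ?_
  ext v : 1
  simp [columnMap, smul_smul, mul_comm]
  abel

theorem half_le_abs_det (h : IsFramedCurve γ τ N N' M) {ρ : ℝ} (hρ : M * ρ ≤ 1 / 4) {x : Space 2}
    (hx : |x 1| ≤ ρ) :
    1 / 2 ≤ |(columnMap (τ (x 0) + x 1 • N' (x 0)) (N (x 0))).det| := by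
  rw [det_columnMap, h.abs_det, inner_add_left, h.inner_tangent_self, real_inner_smul_left]
  have h1 := (abs_inner_le (v := N' (x 0)) (h.norm_tangent (x 0))).trans (h.norm_deriv_normal_le _)
  have h2 : |x 1 * inner ℝ (N' (x 0)) (τ (x 0))| ≤ 1 / 4 := by
    rw [abs_mul]
    have := abs_nonneg (x 1)
    calc _ ≤ ρ * M := mul_le_mul hx h1 (abs_nonneg _) (this.trans hx)
      _ ≤ 1 / 4 := by linarith
  exact le_trans (by linarith [(abs_le.1 h2).1]) (le_abs_self _)

theorem injOn_tubeMap (h : IsFramedCurve γ τ N N' M) {ρ : ℝ} (hρ : M * ρ ≤ 1 / 4) {I : Set ℝ}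
    (hI : ∀ t ∈ I, ∀ t' ∈ I, M * |t' - t| ≤ 1 / 2) :
    InjOn (tubeMap γ N) {x | x 0 ∈ I ∧ x 1 ∈ Ioo (-ρ) ρ} := by
  rintro x ⟨hx0, hx1⟩ x' ⟨hx0', hx1'⟩ heq
  set t := x 0
  set t' := x' 0
  have hr' : |x' 1| ≤ ρ := (abs_lt.2 hx1').le
  set e := γ t' - γ t - (t' - t) • τ t with he
  have heb : ‖e‖ ≤ M * |t' - t| ^ 2 := h.norm_sub_sub_le t t'
  have hz : (t' - t) • τ t + e + x' 1 • (N t' - N t) + (x' 1 - x 1) • N t = 0 := by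
    have h1 : γ t + x 1 • N t = γ t' + x' 1 • N t' := heq
    have h2 : (t' - t) • τ t + e + x' 1 • (N t' - N t) + (x' 1 - x 1) • N t =
        γ t' + x' 1 • N t' - (γ t + x 1 • N t) := by
      rw [he, smul_sub, sub_smul (x' 1)]; abel
    rw [h2, h1, sub_self]
  have h3 := congrArg (fun v => inner ℝ v (τ t)) hz
  simp only [inner_add_left, real_inner_smul_left, h.inner_eq_zero, h.inner_tangent_self,
    inner_zero_left, mul_one, mul_zero, add_zero] at h3
  have h4 := abs_inner_le (v := e) (h.norm_tangent t)
  have h5 := (abs_inner_le (v := N t' - N t) (h.norm_tangent t)).trans (h.lipschitz_normal t t')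
  have h0 := abs_nonneg (t' - t)
  have h6 : |x' 1 * inner ℝ (N t' - N t) (τ t)| ≤ 1 / 4 * |t' - t| := by
    rw [abs_mul]
    calc _ ≤ ρ * (M * |t' - t|) := mul_le_mul hr' h5 (abs_nonneg _) ((abs_nonneg _).trans hr')
      _ = M * ρ * |t' - t| := by ring
      _ ≤ _ := by gcongr
  have h7 : |t' - t| ≤ |inner ℝ e (τ t)| + |x' 1 * inner ℝ (N t' - N t) (τ t)| := by
    rw [show t' - t = -(inner ℝ e (τ t) + x' 1 * inner ℝ (N t' - N t) (τ t)) by linarith, abs_neg]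
    exact abs_add_le _ _
  have h8 := hI t hx0 t' hx0'
  have h9 : |t' - t| = 0 := by nlinarith
  have ht : t' = t := by linarith [abs_eq_zero.1 h9]
  have h10 : x' 1 - x 1 = 0 := by
    rw [ht] at hz he
    have he0 : e = 0 := by rw [he]; simp
    rw [he0] at hz
    simp only [sub_self, zero_smul, smul_zero, zero_add, smul_eq_zero] at hz
    rcases hz with hz | hz
    · exact hz
    · have := h.norm_normal t
      rw [hz, norm_zero] at this
      norm_num at this
  ext i
  fin_cases i
  · exact ht.symm
  · exact (sub_eq_zero.1 h10).symm

/-- Integration in normal coordinates over a short piece of the curve. -/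
theorem lintegral_tube_le (h : IsFramedCurve γ τ N N' M) {ρ : ℝ} (hρ : M * ρ ≤ 1 / 4) {I : Set ℝ}
    (hIm : MeasurableSet I) (hI : ∀ t ∈ I, ∀ t' ∈ I, M * |t' - t| ≤ 1 / 2)
    {F : Space 2 → ℝ≥0∞} (hF : Measurable F) :
    ∫⁻ t in I, ∫⁻ r in Ioo (-ρ) ρ, F (γ t + r • N t) ≤ 2 * ∫⁻ x, F x := by
  have hγc : Continuous γ := continuous_iff_continuousAt.2 fun t => (h.hasDerivAt t).continuousAt
  have hNc : Continuous N :=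
    continuous_iff_continuousAt.2 fun t => (h.hasDerivAt_normal t).continuousAt
  set Q : Set (Space 2) := {x | x 0 ∈ I ∧ x 1 ∈ Ioo (-ρ) ρ} with hQ
  let e : Space 2 → ℝ × ℝ := fun x => (x 0, x 1)
  have he : MeasurePreserving e volume volume :=
    (volume_preserving_finTwoArrow ℝ).comp (PiLp.volume_preserving_ofLp (Fin 2))
  have hQm : MeasurableSet Q := he.measurable (hIm.prod measurableSet_Ioo)
  have hFm : Measurable fun p : ℝ × ℝ => F (γ p.1 + p.2 • N p.1) :=
    hF.comp (by fun_prop : Continuous fun p : ℝ × ℝ => γ p.1 + p.2 • N p.1).measurable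
  have h1 : ∫⁻ t in I, ∫⁻ r in Ioo (-ρ) ρ, F (γ t + r • N t) = ∫⁻ x in Q, F (tubeMap γ N x) := by
    rw [← setLIntegral_prod (fun p : ℝ × ℝ => F (γ p.1 + p.2 • N p.1)) hFm.aemeasurable]
    exact (he.setLIntegral_comp_preimage (hIm.prod measurableSet_Ioo) hFm).symm
  have h2 := lintegral_image_eq_lintegral_abs_det_fderiv_mul volume hQm
    (fun x _ => (h.hasFDerivAt_tubeMap x).hasFDerivWithinAt) (h.injOn_tubeMap hρ hI) F
  rw [h1]
  calc ∫⁻ x in Q, F (tubeMap γ N x)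
      ≤ ∫⁻ x in Q, 2 * (ENNReal.ofReal 
          |(columnMap (τ (x 0) + x 1 • N' (x 0)) (N (x 0))).det| * F (tubeMap γ N x)) := by
        refine setLIntegral_mono' hQm fun x hx => ?_
        have h3 := h.half_le_abs_det hρ (x := x) (abs_lt.2 hx.2).le
        rw [← mul_assoc]
        refine le_mul_of_one_le_left zero_le ?_
        generalize |(columnMap (τ (x 0) + x 1 • N' (x 0)) (N (x 0))).det| = d at h3 ⊢
        rw [← ENNReal.ofReal_ofNat 2, ← ENNReal.ofReal_mul (by norm_num), ENNReal.one_le_ofReal]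
        linarith
    _ = 2 * ∫⁻ x in tubeMap γ N '' Q, F x := by
        rw [lintegral_const_mul' _ _ (by simp), h2]
    _ ≤ _ := by
        gcongr
        exact Measure.restrict_le_self

end IsFramedCurve

/-- Two parameters of a point of a simple closed curve differ by a period. -/
theorem IsSmoothClosedCurve.exists_period {Γ : Set (Space 2)} {μ : Measure (Space 2)}
    {ν : Space 2 → Space 2} {L : ℝ} {γ : ℝ → Space 2} (h : IsSmoothClosedCurve Γ μ ν L γ)
    {t t' : ℝ} (ht : γ t = γ t') : ∃ k : ℤ, t' - t = k * L := by
  obtain ⟨a, ha, -⟩ := existsUnique_add_zsmul_mem_Ico h.length_pos t 0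
  obtain ⟨b, hb, -⟩ := existsUnique_add_zsmul_mem_Ico h.length_pos t' 0
  rw [zero_add] at ha hb
  have h1 := h.simple ha hb (by rw [h.closed.zsmul a t, h.closed.zsmul b t', ht])
  refine ⟨a - b, ?_⟩
  simp only [zsmul_eq_mul] at h1
  push_cast
  linarith

/-- A smooth simple closed curve has a normal tube. -/
theorem IsSmoothClosedCurve.exists_isNormalTube {n : ℕ} {Γ : Set (Space n)} {μ : Measure (Space n)}
    {ν : Space n → Space n} {L : ℝ} {γ : ℝ → Space n} (h : IsSmoothClosedCurve Γ μ ν L γ) :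
    ∃ ρ κ : ℝ, ∃ C : ℝ≥0∞, IsNormalTube Γ μ (Γ.indicator ν) ρ κ C := by
  obtain rfl := h.dim
  obtain ⟨N', M, hfr⟩ := h.exists_isFramedCurve
  have hL := h.length_pos
  have hM := hfr.one_le
  have hM0 : 0 < M := by linarith
  have hγc : Continuous γ := h.smooth.continuous
  have hΓc : IsCompact Γ := by
    rw [h.set_eq]; exact h.closed.compact_of_continuous hL.ne' hγc
  have hmem : ∀ t, γ t ∈ Γ := fun t => by rw [h.set_eq]; exact mem_range_self t
  have hν : ∀ t, Γ.indicator ν (γ t) = ν (γ t) := fun t => indicator_of_mem (hmem t) ν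
  have hνm := measurable_indicator_of_continuousOn hΓc.isClosed h.normal_cont
  obtain ⟨m, hm0, hm⟩ : ∃ m : ℝ, 0 < m ∧ ∀ p ∈ {p : ℝ × ℝ | p.1 ∈ Icc 0 L ∧
      p.2 ∈ Icc (-(L / 2)) (L / 2) ∧ 1 / (2 * M) ≤ |p.2|}, m ≤ dist (γ p.1) (γ (p.1 + p.2)) := by
    refine IsCompact.exists_forall_le' ?_ (by fun_prop) fun p hp => ?_
    · refine ((isCompact_Icc (a := (0 : ℝ)) (b := L)).prod
        (isCompact_Icc (a := -(L / 2)) (b := L / 2))).of_isClosed_subset ?_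
        fun p hp => ⟨hp.1, hp.2.1⟩
      exact (isClosed_Icc.preimage continuous_fst).inter ((isClosed_Icc.preimage continuous_snd).inter
        (isClosed_le continuous_const continuous_snd.abs))
    · refine dist_pos.2 fun heq => ?_
      obtain ⟨k, hk⟩ := h.exists_period heq
      rw [add_sub_cancel_left] at hk
      obtain ⟨-, hp2, hp3⟩ := hp
      have hp3' : 0 < |p.2| := lt_of_lt_of_le (by positivity) hp3
      have hk1 : |(k : ℝ)| * L ≤ L / 2 := by
        rw [← abs_of_pos hL, ← abs_mul, abs_of_pos hL, ← hk]
        exact abs_le.2 hp2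
      have hk2 : |(k : ℝ)| < 1 := by nlinarith
      have hk3 : k = 0 := by
        rw [← Int.cast_abs] at hk2
        exact Int.abs_lt_one_iff.1 (by exact_mod_cast hk2)
      rw [hk, hk3] at hp3'
      simp at hp3'
  set ρ := min (1 / (4 * M)) (m / 2) with hρ
  have hρ0 : 0 < ρ := lt_min (by positivity) (by positivity)
  have hρM : M * ρ ≤ 1 / 4 := by
    calc M * ρ ≤ M * (1 / (4 * M)) := by gcongr; exact min_le_left _ _
      _ = 1 / 4 := by field_simp
  obtain ⟨J, hJ⟩ := exists_nat_ge (L * (2 * M))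
  have hdist : ∀ t t' r : ℝ, |r| < ρ → 1 / 2 * |r| ≤ dist (γ t + r • ν (γ t)) (γ t') := by
    intro t t' r hr
    obtain ⟨a, ha, -⟩ := existsUnique_add_zsmul_mem_Ico hL t 0
    obtain ⟨b, hb, -⟩ := existsUnique_add_zsmul_mem_Ico hL t' (t + a • L - L / 2)
    rw [zero_add] at ha
    rw [← h.closed.zsmul a t, ← h.closed.zsmul b t']
    set u := t + a • L
    set u' := t' + b • L
    by_cases hclose : M * |u' - u| ≤ 1 / 2
    · exact hfr.half_abs_le_dist r hclose
    · have h1 := hm (u, u' - u) ⟨⟨ha.1, ha.2.le⟩, ⟨by linarith [hb.1], by linarith [hb.2]⟩, by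
        rw [div_le_iff₀ (by positivity)]
        push Not at hclose
        linarith⟩
      simp only [add_sub_cancel] at h1
      have h2 : dist (γ u) (γ u + r • ν (γ u)) = |r| := by
        rw [dist_eq_norm, sub_add_cancel_left, norm_neg, norm_smul, h.normal_unit, mul_one,
          Real.norm_eq_abs]
      have h3 := dist_triangle (γ u) (γ u + r • ν (γ u)) (γ u')
      have h4 : ρ ≤ m / 2 := min_le_right _ _
      linarith [abs_nonneg r]
  have hpar : ∀ y ∈ Γ, ∃ t, y = γ t := fun y hy => by
    rw [h.set_eq] at hy
    obtain ⟨t, rfl⟩ := hy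
    exact ⟨t, rfl⟩
  have hslice : Measurable fun p : Space 2 × ℝ => p.1 + p.2 • Γ.indicator ν p.1 := by fun_prop
  refine ⟨ρ, 1 / 2, J * 2, ⟨hΓc, ⟨_, hmem 0⟩, ?_, ?_, hνm, ?_, ?_, hρ0, by norm_num, ?_,
    by finiteness, ?_⟩⟩
  · rw [h.measure_eq]
    infer_instance
  · rw [h.measure_eq]
    exact (ae_map_iff (p := fun y => y ∈ Γ) hγc.measurable.aemeasurable
      hΓc.isClosed.measurableSet).2 (Eventually.of_forall hmem)
  · exact h.normal_cont.congr fun y hy => indicator_of_mem hy ν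
  · intro y hy
    obtain ⟨t, rfl⟩ := hpar y hy
    rw [hν, h.normal_unit]
  · intro y hy r hr
    obtain ⟨t, rfl⟩ := hpar y hy
    rw [Metric.le_infDist ⟨_, hmem 0⟩, hν]
    intro z hz
    obtain ⟨t', rfl⟩ := hpar z hz
    exact hdist t t' r hr
  · intro F hF
    have hg : Measurable fun y => ∫⁻ r in Ioo (-ρ) ρ, F (y + r • Γ.indicator ν y) :=
      (hF.comp hslice).lintegral_prod_right'
    rw [h.measure_eq, lintegral_map hg hγc.measurable]
    simp only [hν]
    have hcover : Ico 0 L ⊆ ⋃ j : Fin J, Ico ((j : ℝ) / (2 * M)) (((j : ℝ) + 1) / (2 * M)) := by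
      intro t ht
      have h0 : 0 ≤ t * (2 * M) := mul_nonneg ht.1 (by positivity)
      have h1 : ⌊t * (2 * M)⌋₊ < J := by
        rw [Nat.floor_lt h0]
        exact (mul_lt_mul_of_pos_right ht.2 (by positivity)).trans_le hJ
      refine mem_iUnion.2 ⟨⟨_, h1⟩, ?_⟩
      rw [mem_Ico, div_le_iff₀ (by positivity), lt_div_iff₀ (by positivity)]
      exact ⟨Nat.floor_le h0, Nat.lt_floor_add_one _⟩
    calc ∫⁻ t in Ico 0 L, ∫⁻ r in Ioo (-ρ) ρ, F (γ t + r • ν (γ t))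
        ≤ ∫⁻ t in ⋃ j : Fin J, Ico ((j : ℝ) / (2 * M)) (((j : ℝ) + 1) / (2 * M)),
          ∫⁻ r in Ioo (-ρ) ρ, F (γ t + r • ν (γ t)) := lintegral_mono_set hcover
      _ ≤ ∑' j : Fin J, ∫⁻ t in Ico ((j : ℝ) / (2 * M)) (((j : ℝ) + 1) / (2 * M)),
          ∫⁻ r in Ioo (-ρ) ρ, F (γ t + r • ν (γ t)) := lintegral_iUnion_le _ _
      _ ≤ ∑' j : Fin J, 2 * ∫⁻ x, F x := by
          refine ENNReal.tsum_le_tsum fun j => hfr.lintegral_tube_le hρM measurableSet_Ico ?_ hF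
          intro t ht t' ht'
          have h1 : |t' - t| ≤ 1 / (2 * M) := by
            have h2 : ((j : ℝ) + 1) / (2 * M) = (j : ℝ) / (2 * M) + 1 / (2 * M) := by ring
            rw [h2] at ht ht'
            rw [abs_le]
            constructor <;> linarith [ht.1, ht.2, ht'.1, ht'.2]
          calc M * |t' - t| ≤ M * (1 / (2 * M)) := by gcongr
            _ = 1 / 2 := by field_simp
      _ = _ := by simp [tsum_fintype, mul_assoc]

theorem IsDegenerationSet.exists_isNormalTube {n : ℕ} {Γ : Set (Space n)} {μ : Measure (Space n)}
    {ν : Space n → Space n} (h : IsDegenerationSet Γ μ ν) :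
    ∃ ρ κ : ℝ, ∃ C : ℝ≥0∞, IsNormalTube Γ μ (Γ.indicator ν) ρ κ C := by
  rcases h with h | ⟨L, γ, h⟩
  exacts [h.exists_isNormalTube, h.exists_isNormalTube]

theorem IsDegenerationSet.subset_box {n : ℕ} {Γ : Set (Space n)} {μ : Measure (Space n)}
    {ν : Space n → Space n} (h : IsDegenerationSet Γ μ ν) : Γ ⊆ box n := by
  rcases h with h | ⟨L, γ, h⟩
  · rw [h.set_eq]
    rintro x (rfl | rfl) i <;> norm_num
  · exact h.subset_box

theorem isTraceAlong_parallel_indicator {n : ℕ} {Γ : Set (Space n)} {μ : Measure (Space n)}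
    (hμ : ∀ᵐ y ∂μ, y ∈ Γ) (ν : Space n → Space n) (l : ℝ) (u : Space n → ℝ) (g : Lp ℝ 2 μ) :
    IsTraceAlong Γ μ (parallel (Γ.indicator ν) l) u g ↔ IsTraceAlong Γ μ (parallel ν l) u g := by
  have h1 : ∀ y ∈ Γ, parallel (Γ.indicator ν) l y = parallel ν l y := fun y hy => by
    rw [parallel, parallel, indicator_of_mem hy]
  have h2 : ∀ φ : Space n → ℝ, eLpNorm (fun y => φ (parallel (Γ.indicator ν) l y) - g y) 2 μ =
      eLpNorm (fun y => φ (parallel ν l y) - g y) 2 μ := fun φ =>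
    eLpNorm_congr_ae (hμ.mono fun y hy => by simp only [h1 y hy])
  have h3 : ∀ U : Set (Space n), (∀ y ∈ Γ, parallel (Γ.indicator ν) l y ∈ U) ↔
      ∀ y ∈ Γ, parallel ν l y ∈ U := fun U =>
    forall₂_congr fun y hy => by rw [h1 y hy]
  simp only [IsTraceAlong, h2, h3]

end Degenerate

theorem mainTheorem8 {n : ℕ} (Γ : Set (Degenerate.Space n)) (μ : Measure (Degenerate.Space n))
    (ν : Degenerate.Space n → Degenerate.Space n) (hΓ : Degenerate.IsDegenerationSet Γ μ ν)
    (s : ℝ) (α : Degenerate.Space n → ℝ) (hα : Degenerate.IsDiffusivity Γ s α) :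
    ∃ T : Degenerate.weightedH1 α →ₗ[ℝ] Lp ℝ 2 μ,
      (∃ C : ℝ, ∀ u : Degenerate.weightedH1 α,
        ‖T u‖ ≤ C * Degenerate.weightedH1Norm α (u : Degenerate.Space n → ℝ)) ∧
      (∀ u : Degenerate.weightedH1 α, ContDiff ℝ ∞ (u : Degenerate.Space n → ℝ) →
        (T u : Degenerate.Space n → ℝ) =ᵐ[μ] (u : Degenerate.Space n → ℝ)) ∧
      ∃ Λ : ℝ, 0 < Λ ∧ ∃ R : ℝ → Degenerate.weightedH1 α → Lp ℝ 2 μ,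
        (∀ l : ℝ, 0 < |l| → |l| < Λ → ∀ (u : Degenerate.weightedH1 α) (g : Lp ℝ 2 μ),
          Degenerate.IsTraceAlong Γ μ (Degenerate.parallel ν l) (u : Degenerate.Space n → ℝ) g ↔
            g = R l u) ∧
        ∀ u : Degenerate.weightedH1 α,
          Tendsto (fun l => R l u) (𝓝[≠] (0 : ℝ)) (𝓝 (T u)) := by
  obtain ⟨ρ₀, κ, C, htube⟩ := hΓ.exists_isNormalTube
  obtain ⟨δ, hδ, N, hN, hE⟩ := hα.exists_hasEnergyNear htube.compact htube.nonempty hΓ.subset_box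
  have hρ : 0 < min ρ₀ (δ / 2) := lt_min htube.radius_pos (by positivity)
  obtain ⟨T, ⟨K, hK, hT⟩, hsmooth, R, hR, hlim⟩ :=
    (htube.mono hρ (min_le_left _ _)).exists_trace_operator hα.exponent.1 hα.exponent.2
      ((min_le_right _ _).trans_lt (half_lt_self hδ)) hE
  refine ⟨T, ⟨√(K * N).toReal, fun u => ?_⟩, hsmooth, _, hρ, R, fun l h0 hl u g => ?_, hlim⟩
  · have hnn : 0 ≤ Degenerate.weightedH1Norm α (u : Degenerate.Space n → ℝ) := Real.sqrt_nonneg _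
    have h1 := ENNReal.toReal_mono (by finiteness) (hT u)
    rw [← mul_assoc, ENNReal.toReal_mul, ENNReal.toReal_ofReal (sq_nonneg _), ENNReal.toReal_pow,
      toReal_enorm] at h1
    rw [← sq_le_sq₀ (norm_nonneg _) (by positivity), mul_pow,
      Real.sq_sqrt ENNReal.toReal_nonneg]
    exact h1
  · rw [← Degenerate.isTraceAlong_parallel_indicator htube.ae_mem ν]
    exact hR l h0 hl u g
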